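/- Definitions. A (bijective) numbering of a set $X$ is a bijection $\nu\colon N\to X$ where $N\subseteq\mathbb N$ is a decidable set; the elements of $N$ are called names. A function $f\colon X\to X'$ between sets with numberings $\nu,\nu'$ is computable if $\nu'^{-1}\circ f\circ\nu$ is a computable function, and a subset of $X$ is decidable if the set of names of its elements is decidable. Products carry the numbering obtained from a computable pairing bijection $\mathbb N^2\to\mathbb N$, and $\mathbb N$ and $\mathbb Z$ carry their standard numberings. All graphs are undirected, simple and without loops. A highly computable graph is a locally finite graph $\Gamma$ with a numbering of its vertex set $V(\Gamma)$ such that the adjacency relation is a decidable subset of $V(\Gamma)^2$ and the degree function $V(\Gamma)\to\mathbb N$ is computable. The number of ends of $\Gamma$ is the supremum, over all finite $K\subseteq V(\Gamma)$, of the number of infinite connected components of $\Gamma-K$. Let $d$ be the path-length metric of a connected graph $\Gamma$. A right action $\ast$ of $\mathbb Z$ on $V(\Gamma)$ is translation-like if it is free and, for every $n\in\mathbb Z$, the set $\{d(v,v\ast n) : v\in V(\Gamma)\}$ is bounded; it is computable if the function $V(\Gamma)\times\mathbb Z\to V(\Gamma)$, $(v,n)\mapsto v\ast n$, is computable. Theorem.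 Let $\Gamma$ be a highly computable graph that is connected and has one or two ends. Then $\mathbb Z$ admits a right action $\ast$ on $V(\Gamma)$ that is translation-like, transitive and computable (with respect to the given numbering of $V(\Gamma)$), and satisfies $d(v,v\ast 1)\le 3$ for every vertex $v$. -/

import Mathlib

open scoped RightActions

/-- A (bijective) numbering of `X`: a bijection onto `X` from a decidable set of natural numbers
(the names of the elements of `X`). -/
structure BijNumbering (X : Type*) where
  names : Set ℕ
  decidable_names : ComputablePred fun n : ℕ => n ∈ names
  toEquiv : names ≃ X

namespace BijNumbering

/-- The standard numbering of `ℕ`: every number is its own name. -/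
def nat : BijNumbering ℕ where
  names := Set.univ
  decidable_names := ⟨fun _ => isTrue trivial, (Computable.const true).of_eq fun _ => rfl⟩
  toEquiv := Equiv.Set.univ ℕ

/-- The standard numbering of `ℤ`: `2 * n` is the name of `n` and `2 * n + 1` is the name
of `-(n + 1)`, for `n : ℕ`. -/
def int : BijNumbering ℤ where
  names := Set.univ
  decidable_names := ⟨fun _ => isTrue trivial, (Computable.const true).of_eq fun _ => rfl⟩
  toEquiv := (Equiv.Set.univ ℕ).trans Equiv.intEquivNat.symm

/-- The numbering of a product, through the computable pairing bijection `Nat.pair`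
between `ℕ × ℕ` and `ℕ`. -/
def prod {X Y : Type*} (ν : BijNumbering X) (μ : BijNumbering Y) : BijNumbering (X × Y) where
  names := {n | n.unpair.1 ∈ ν.names ∧ n.unpair.2 ∈ μ.names}
  decidable_names := by
    obtain ⟨f, hf, hf'⟩ := ComputablePred.computable_iff.1 ν.decidable_names
    obtain ⟨g, hg, hg'⟩ := ComputablePred.computable_iff.1 μ.decidable_names
    refine ComputablePred.computable_iff.2
      ⟨fun n => f n.unpair.1 && g n.unpair.2, ?_, ?_⟩
    · exact Primrec.and.to_comp.comp
        (hf.comp (Computable.fst.comp Computable.unpair))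
        (hg.comp (Computable.snd.comp Computable.unpair))
    · funext n
      have h1 := congrFun hf' n.unpair.1
      have h2 := congrFun hg' n.unpair.2
      simp only [Bool.and_eq_true, ← h1, ← h2]
      rfl
  toEquiv :=
    { toFun := fun n => (ν.toEquiv ⟨n.1.unpair.1, n.2.1⟩, μ.toEquiv ⟨n.1.unpair.2, n.2.2⟩)
      invFun := fun p => ⟨Nat.pair (ν.toEquiv.symm p.1) (μ.toEquiv.symm p.2), by simp⟩
      left_inv := fun n => by simp
      right_inv := fun p => by simp }

/-- A subset of a numbered set is decidable if the set of names of its elements is. -/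
def IsDecidable {X : Type*} (ν : BijNumbering X) (S : Set X) : Prop :=
  ComputablePred fun n : ℕ => ∃ h : n ∈ ν.names, ν.toEquiv ⟨n, h⟩ ∈ S

/-- A function between numbered sets is computable if some computable function on `ℕ` maps
the name of each `x` to the name of `f x`. As the set of names is decidable, it is no restriction
to take the function on `ℕ` total, with arbitrary values outside the set of names. -/
def IsComputable {X Y : Type*} (ν : BijNumbering X) (μ : BijNumbering Y) (f : X → Y) : Prop :=
  ∃ F : ℕ → ℕ, Computable F ∧ ∀ n : ν.names, F n = μ.toEquiv.symm (f (ν.toEquiv n))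

end BijNumbering

namespace SimpleGraph

/-- `G`, with the numbering `ν` of its vertices, is a computable graph. -/
def IsComputableGraph {V : Type*} (G : SimpleGraph V) (ν : BijNumbering V) : Prop :=
  (ν.prod ν).IsDecidable {p : V × V | G.Adj p.1 p.2}

/-- `G`, with the numbering `ν` of its vertices, is a highly computable graph: it is computable,
locally finite, and the degree of a vertex is a computable function. -/
structure IsHighlyComputable {V : Type*} (G : SimpleGraph V) (ν : BijNumbering V) : Prop where
  computable : G.IsComputableGraph ν
  locallyFinite : ∀ v : V, (G.neighborSet v).Finite
  computable_degree : ν.IsComputable BijNumbering.nat fun v : V => (G.neighborSet v).ncard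

/-- The number of ends: the supremum, over the finite sets `K` of vertices, of the number of
infinite connected components of `G - K`. -/
noncomputable def numEnds {V : Type*} (G : SimpleGraph V) : ℕ∞ :=
  ⨆ K : Finset V, {C : G.ComponentCompl (K : Set V) | C.supp.Infinite}.encard

/-- A right action of the additive group `H` on the vertices of `G` is translation-like if it is
free and, for each `h : H`, the path-length distance from `v` to `v <+ᵥ h` is bounded. -/
structure IsTranslationLike {V : Type*} (G : SimpleGraph V) (H : Type*) [AddGroup H]
    [AddAction Hᵃᵒᵖ V] : Prop where
  free : ∀ (v : V) (h : H), v <+ᵥ h = v → h = 0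
  bounded : ∀ h : H, ∃ C : ℕ, ∀ v : V, G.edist v (v <+ᵥ h) ≤ C

end SimpleGraph

/-! It suffices to find a bijection `E : ℤ ≃ V`, computable on names, with consecutive values at
distance at most 3: the action is then `E (E.symm v + n)`, and `E.symm` is computed by searching
through the values of `E`. The line `E` is the limit of finite 3-paths that are prolonged at both
ends forever.

Combinatorics. A finite connected set has a Hamiltonian 3-path between any two distinct vertices,
which moreover has a jump of length at most 2 at any prescribed vertex `s` (`ConnectedOn.split`). If
the unvisited part is one-ended, enclose the vertices to be visited in a finite connected set whose
removal leaves a one-ended set, choose `s` in it with a neighbour outside, and cut the path at the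
short jump at `s`: both halves stop within distance 3 of two distinct unvisited vertices
(`OneEnded.exists_ham_pair`). If the graph has two ends, let the path first cover a finite set `K`
separating them; the unvisited part then has one one-ended component for each end of the path, and
the two ends are prolonged independently (`OneEnded.exists_ham`).

Computability. A search must never choose a finite path that cannot be prolonged, yet infinitude of
a component is not something a search can recognize directly. The invariant `Covers` avoids it:
every unvisited vertex is joined to one of the two entrances `u`, `v`, and these are joined to each
other in the one-ended case. Once `K` is visited, this alone forces the components to be the right
ones, so each state satisfying the invariant can be prolonged (`EndsAs.exists_extension`). The
invariant need only be checked at neighbours of the finite path, and the degree function certifies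
that a list of neighbours is complete, so it is semidecidable (`sigmaOne_isPartialLine`). Unbounded
search therefore succeeds at every stage. The number of ends, the set `K` and the initial path are
finite data that need not be computed. -/

namespace SimpleGraph

/-! ### Walks and components inside a set of vertices. -/

variable {W : Type*} {G : SimpleGraph W} {S T U K F : Set W} {a b c s u v x y z : W}

/-- `x` and `y` are joined by a walk of `G` all of whose edges lie inside `U`. -/
def Joined (G : SimpleGraph W) (U : Set W) : W → W → Prop :=
  Relation.ReflTransGen fun a b => G.Adj a b ∧ a ∈ U ∧ b ∈ U

/-- The subgraph of `G` induced on `S` is preconnected. -/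
def ConnectedOn (G : SimpleGraph W) (S : Set W) : Prop :=
  ∀ x ∈ S, ∀ y ∈ S, G.Joined S x y

/-- The vertices joined to `x` within `U`. -/
def componentIn (G : SimpleGraph W) (U : Set W) (x : W) : Set W :=
  {y | G.Joined U x y}

namespace Joined

theorem refl (x : W) : G.Joined U x x := Relation.ReflTransGen.refl

theorem of_adj (h : G.Adj x y) (hx : x ∈ U) (hy : y ∈ U) : G.Joined U x y := .single ⟨h, hx, hy⟩

theorem trans (h : G.Joined U x y) (h' : G.Joined U y z) : G.Joined U x z :=
  Relation.ReflTransGen.trans h h'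

theorem symm (h : G.Joined U x y) : G.Joined U y x := by
  induction h with
  | refl => exact .refl _
  | tail _ h ih => exact (of_adj h.1.symm h.2.2 h.2.1).trans ih

theorem mono (hST : S ⊆ T) (h : G.Joined S x y) : G.Joined T x y :=
  Relation.ReflTransGen.mono (fun _ _ h => ⟨h.1, hST h.2.1, hST h.2.2⟩) _ _ h

theorem mem (h : G.Joined U x y) (hx : x ∈ U) : y ∈ U := by
  induction h with
  | refl => exact hx
  | tail _ h _ => exact h.2.2

/-- A walk cannot leave a set that is closed under adjacency. -/
theorem inter (h : G.Joined U x y) (hx : x ∈ S)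
    (hS : ∀ a b, a ∈ S → a ∈ U → b ∈ U → G.Adj a b → b ∈ S) : G.Joined (U ∩ S) x y ∧ y ∈ S := by
  induction h with
  | refl => exact ⟨.refl _, hx⟩
  | tail _ h ih =>
    have := hS _ _ ih.2 h.2.1 h.2.2 h.1
    exact ⟨ih.1.trans (of_adj h.1 ⟨h.2.1, ih.2⟩ ⟨h.2.2, this⟩), this⟩

/-- A walk from outside `S` to a point of `S` has a first edge into `S`. -/
theorem exists_adj (h : G.Joined U x y) (hx : x ∈ U \ S) (hy : y ∈ S) :
    ∃ z ∈ U \ S, G.Joined (U \ S) x z ∧ ∃ a ∈ S, a ∈ U ∧ G.Adj z a := by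
  by_contra! hcon
  have key : G.Joined (U \ S) x y ∧ y ∉ S := by
    clear hy
    induction h with
    | refl => exact ⟨.refl _, hx.2⟩
    | @tail b c _ h ih =>
      have hb : b ∈ U \ S := ⟨h.2.1, ih.2⟩
      have hc : c ∉ S := fun hc => hcon b hb ih.1 c hc h.2.2 h.1
      exact ⟨ih.1.trans (of_adj h.1 hb ⟨h.2.2, hc⟩), hc⟩
  exact key.2 hy

end Joined

theorem componentIn_subset (hx : x ∈ U) : G.componentIn U x ⊆ U := fun _ h => h.mem hx

theorem mem_componentIn_self : x ∈ G.componentIn U x := .refl x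

theorem componentIn_eq (h : G.Joined U x y) : G.componentIn U x = G.componentIn U y :=
  Set.ext fun _ => ⟨fun h' => h.symm.trans h', fun h' => h.trans h'⟩

theorem connectedOn_componentIn : G.ConnectedOn (G.componentIn U x) := by
  have key : ∀ y ∈ G.componentIn U x, G.Joined (G.componentIn U x) x y := fun y hy =>
    (Joined.inter hy mem_componentIn_self
      fun a b ha haU hbU hab => Joined.trans ha (.of_adj hab haU hbU)).1.mono Set.inter_subset_right
  exact fun y hy z hz => (key y hy).symm.trans (key z hz)

theorem connectedOn_of_forall (r : W) (h : ∀ x ∈ S, G.Joined S r x) : G.ConnectedOn S :=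
  fun x hx y hy => (h x hx).symm.trans (h y hy)

theorem connectedOn_singleton (a : W) : G.ConnectedOn {a} := by
  rintro x rfl y rfl; exact .refl _

theorem ConnectedOn.union (hS : G.ConnectedOn S) (hT : G.ConnectedOn T) (ha : a ∈ S)
    (hb : b ∈ T) (hab : a = b ∨ G.Adj a b) : G.ConnectedOn (S ∪ T) := by
  have hj : G.Joined (S ∪ T) a b := by
    rcases hab with rfl | hab
    · exact .refl _
    · exact .of_adj hab (.inl ha) (.inr hb)
  refine connectedOn_of_forall a fun x hx => ?_
  rcases hx with hx | hx
  · exact (hS a ha x hx).mono Set.subset_union_left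
  · exact hj.trans ((hT b hb x hx).mono Set.subset_union_right)

theorem ConnectedOn.exists_adj (hU : G.ConnectedOn U) (hSU : S ⊆ U) (hS : S.Nonempty)
    (hx : x ∈ U \ S) : ∃ z ∈ U \ S, G.Joined (U \ S) x z ∧ ∃ a ∈ S, G.Adj a z := by
  obtain ⟨s, hs⟩ := hS
  obtain ⟨z, hz, hxz, a, ha, -, hza⟩ := (hU x hx.1 s (hSU hs)).exists_adj hx hs
  exact ⟨z, hz, hxz, a, ha, hza.symm⟩

theorem ConnectedOn.exists_adj_self (hU : G.ConnectedOn U) (hx : x ∈ U) (hy : y ∈ U)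
    (hxy : x ≠ y) : ∃ z ∈ U, G.Adj x z := by
  obtain ⟨z, hz, -, a, ha, haz⟩ := hU.exists_adj (S := {x}) (by simpa using hx) ⟨x, rfl⟩
    (x := y) ⟨hy, by simpa using hxy.symm⟩
  obtain rfl : a = x := ha
  exact ⟨z, hz.1, haz⟩

/-! ### Hamiltonian 3-paths in finite connected sets -/

/-- `S` is traversed, without repetition and with jumps of length at most 3, by a path
from `u` to `v`. -/
inductive Ham (G : SimpleGraph W) : Set W → W → W → Prop
  | single (a : W) : Ham G {a} a a
  | append {S T : Set W} {u a b v : W} (h : Ham G S u a) (h' : Ham G T b v)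
      (hST : Disjoint S T) (hab : G.edist a b ≤ 3) : Ham G (S ∪ T) u v

theorem Ham.symm (h : G.Ham S u v) : G.Ham S v u := by
  induction h with
  | single a => exact .single a
  | append _ _ hST hab ih ih' =>
    rw [Set.union_comm]
    exact .append ih' ih hST.symm (by rwa [edist_comm])

theorem Ham.exists_list (h : G.Ham S u v) :
    ∃ l : List W, l.head? = some u ∧ l.getLast? = some v ∧ l.Nodup ∧
      (∀ x, x ∈ l ↔ x ∈ S) ∧ l.IsChain fun a b => G.edist a b ≤ 3 := by
  induction h with
  | single a => exact ⟨[a], by simp⟩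
  | append _ _ hST hab ih ih' =>
    obtain ⟨l, hhead, hlast, hnd, hmem, hch⟩ := ih
    obtain ⟨m, hhead', hlast', hnd', hmem', hch'⟩ := ih'
    refine ⟨l ++ m, ?_, ?_, ?_, ?_, ?_⟩
    · rw [List.head?_append, hhead]; rfl
    · rw [List.getLast?_append, hlast']; rfl
    · refine List.Nodup.append hnd hnd' fun x hx hx' => ?_
      exact Set.disjoint_left.1 hST ((hmem x).1 hx) ((hmem' x).1 hx')
    · intro x
      rw [List.mem_append, hmem, hmem']; rfl
    · refine List.isChain_append.2 ⟨hch, hch', ?_⟩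
      rw [hlast, hhead']
      rintro x hx y hy
      simp only [Option.mem_def, Option.some.injEq] at hx hy
      subst hx hy
      exact hab

/-- `S` is traversed by a 3-path from `u` to `v` with a jump of length at most 2 at `s`; cut there,
it consists of two paths starting at `u` and `v`. -/
def Split (G : SimpleGraph W) (S : Set W) (u v s : W) : Prop :=
  ∃ T₁ T₂ a b, T₁ ∪ T₂ = S ∧ Disjoint T₁ T₂ ∧ G.Ham T₁ u a ∧ G.Ham T₂ v b ∧
    G.edist a b ≤ 2 ∧ (s = a ∨ s = b)

theorem Split.symm (h : G.Split S u v s) : G.Split S v u s := by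
  obtain ⟨T₁, T₂, a, b, rfl, hd, h₁, h₂, hab, hs⟩ := h
  exact ⟨T₂, T₁, b, a, Set.union_comm _ _, hd.symm, h₂, h₁, by rwa [edist_comm], hs.symm⟩

theorem Split.ham (h : G.Split S u v s) : G.Ham S u v := by
  obtain ⟨T₁, T₂, a, b, rfl, hd, h₁, h₂, hab, hs⟩ := h
  exact h₁.append h₂.symm hd (hab.trans (by norm_num))

theorem edist_le_symm {n : ℕ∞} (h : G.edist a b ≤ n) : G.edist b a ≤ n :=
  edist_comm.trans_le h

theorem edist_le_one_of_adj (h : G.Adj a b) : G.edist a b ≤ 1 := (edist_eq_one_iff_adj.2 h).le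

theorem edist_le_add {m n : ℕ∞} (h : G.edist a b ≤ m) (h' : G.edist b c ≤ n) :
    G.edist a c ≤ m + n :=
  G.edist_triangle.trans (add_le_add h h')

/-- In a finite connected set, `r` is the start of a Hamiltonian path ending near `r₀`, which has
a short jump at each given vertex unless the set is `{r}`. -/
theorem ConnectedOn.exists_ham_of_split (hS : G.ConnectedOn S) (hr : u ∈ S) (hr₀ : v ∈ S)
    (h : ∀ w ∈ S, ∀ s ∈ S, u ≠ w → G.Split S u w s) :
    ∃ w, G.edist v w ≤ 1 ∧ G.Ham S u w ∧
      (S = {u} ∧ w = u ∧ v = u ∨ ∀ s ∈ S, G.Split S u w s) := by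
  -- A path cannot end where it starts unless it is trivial, so when `v = u` the end is moved to a
  -- neighbour; hence only distance at most 1 from `v` is promised.
  by_cases huv : u = v
  · subst huv
    by_cases hSu : S = {u}
    · subst hSu
      exact ⟨u, by simp, .single u, .inl ⟨rfl, rfl, rfl⟩⟩
    · obtain ⟨y, hy, hyu⟩ : ∃ y ∈ S, y ≠ u := by
        by_contra! hcon
        exact hSu (Set.eq_singleton_iff_unique_mem.2 ⟨hr, hcon⟩)
      obtain ⟨w, hw, huw⟩ := hS.exists_adj_self hr hy hyu.symm
      exact ⟨w, edist_le_one_of_adj huw, (h w hw u hr huw.ne).ham,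
        .inr fun s hs => h w hw s hs huw.ne⟩
  · exact ⟨v, by simp, (h v hr₀ u hr huv).ham, .inr fun s hs => h v hr₀ s hs huv⟩

/-- Induction on the size of `S`. Removing the component `C` of `v` in `S \ {u}` leaves two smaller
connected sets, joined by an edge from `u` to some `v₀` in `C`. Traverse `S \ C` from `u` to a point
within 1 of `u`, and `C` from `v` to a point within 1 of `v₀`; the connecting jump has length at
most 1 + 1 + 1. The short jump at `s` comes by induction from the piece containing `s`; if that
piece is a single vertex, the connecting jump itself has length at most 2. -/
theorem ConnectedOn.split (hfin : S.Finite) (hS : G.ConnectedOn S) (hu : u ∈ S) (hv : v ∈ S)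
    (hs : s ∈ S) (huv : u ≠ v) : G.Split S u v s := by
  induction hn : S.ncard using Nat.strong_induction_on generalizing S u v s with
  | _ n ih =>
  subst hn
  set C := G.componentIn (S \ {u}) v with hC
  have hvU : v ∈ S \ {u} := ⟨hv, fun h => huv h.symm⟩
  have hCS : C ⊆ S \ {u} := componentIn_subset hvU
  have hvC : v ∈ C := mem_componentIn_self
  have huC : u ∉ C := fun h => (hCS h).2 rfl
  have hCconn : G.ConnectedOn C := connectedOn_componentIn
  -- From here on `u` is called `a`.
  obtain ⟨v₀, -, hvv₀, a, rfl, huv₀⟩ :=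
    hS.exists_adj (S := {u}) (by simpa using hu) ⟨u, rfl⟩ hvU
  have hv₀C : v₀ ∈ C := hvv₀
  have hBconn : G.ConnectedOn (S \ C) := by
    refine connectedOn_of_forall a fun x hx => ?_
    by_cases hxa : x = a
    · subst hxa; exact .refl _
    · obtain ⟨z, hz, hxz, b, rfl, hbz⟩ := hS.exists_adj (S := {a}) (by simpa using hu) ⟨a, rfl⟩
        (x := x) ⟨hx.1, hxa⟩
      have h1 := Joined.inter (S := Cᶜ) hxz hx.2 fun c d hc hcU hdU hcd hd =>
        hc (Joined.trans hd (.of_adj hcd.symm hdU hcU))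
      refine (Joined.trans (h1.1.mono (T := S \ C) ?_)
        (Joined.of_adj hbz.symm ⟨hz.1, h1.2⟩ ⟨hu, huC⟩)).symm
      exact fun y hy => ⟨hy.1.1, hy.2⟩
  have hcardB : (S \ C).ncard < S.ncard :=
    Set.ncard_lt_ncard ⟨Set.sdiff_subset, fun h => (h hv).2 hvC⟩ hfin
  have hcardC : C.ncard < S.ncard :=
    Set.ncard_lt_ncard ⟨fun x hx => (hCS hx).1, fun h => huC (h hu)⟩ hfin
  obtain ⟨u', hu', hamB, hB⟩ := hBconn.exists_ham_of_split (u := a) (v := a)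
    (show a ∈ S \ C from ⟨hu, huC⟩)
    ⟨hu, huC⟩ fun w hw s hs haw => ih _ hcardB hfin.sdiff hBconn ⟨hu, huC⟩ hw hs haw rfl
  obtain ⟨v', hv', hamC, hC'⟩ := hCconn.exists_ham_of_split hvC hv₀C
    fun w hw s hs haw =>
      ih _ hcardC (hfin.subset fun x hx => (hCS hx).1) hCconn hvC hw hs haw rfl
  have hdisj : Disjoint (S \ C) C := Set.disjoint_sdiff_left
  have hunion : (S \ C) ∪ C = S := Set.sdiff_union_of_subset fun x hx => (hCS hx).1
  have hav' : G.edist a v' ≤ 2 :=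
    (edist_le_add (edist_le_one_of_adj huv₀) hv').trans (by norm_num)
  have hu'v' : G.edist u' v' ≤ 3 :=
    (edist_le_add (edist_le_symm hu') hav').trans (by norm_num)
  -- The piece containing `s` is cut at its short jump, and the whole other piece is attached to the
  -- half that starts at the connecting jump.
  by_cases hsC : s ∈ C
  · rcases hC' with ⟨hCv, rfl, rfl⟩ | hC'
    · have hsv : s = v₀ := by rwa [hCv] at hsC
      refine ⟨S \ C, C, u', v₀, hunion, hdisj, hamB, hamC, ?_, .inr hsv⟩
      exact (edist_le_add (edist_le_symm hu') (edist_le_one_of_adj huv₀)).trans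
        (by norm_num)
    · obtain ⟨T₁, T₂, c, d, hT, hd, h₁, h₂, hcd, hs'⟩ := hC' s hsC
      have hdisj' := hdisj.mono_right (Set.subset_union_left.trans hT.le)
      have hdisj'' := hdisj.mono_right (Set.subset_union_right.trans hT.le)
      refine ⟨(S \ C) ∪ T₂, T₁, d, c, ?_, ?_, ?_, h₁, by rwa [edist_comm], hs'.symm⟩
      · rw [Set.union_assoc, Set.union_comm T₂, hT, hunion]
      · exact Set.disjoint_union_left.2 ⟨hdisj', hd.symm⟩
      · exact hamB.append h₂ hdisj'' hu'v'
  · rcases hB with ⟨hBa, rfl, -⟩ | hB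
    · have hsa : s = u' := by
        have : s ∈ S \ C := ⟨hs, hsC⟩
        rwa [hBa] at this
      exact ⟨S \ C, C, u', v', hunion, hdisj, hamB, hamC, hav', .inl hsa⟩
    · obtain ⟨T₁, T₂, c, d, hT, hd, h₁, h₂, hcd, hs'⟩ := hB s ⟨hs, hsC⟩
      rw [← hT] at hdisj
      refine ⟨T₁, C ∪ T₂, c, d, ?_, ?_, h₁, ?_, hcd, hs'⟩
      · rw [Set.union_comm C, ← Set.union_assoc, hT, hunion]
      · exact Set.disjoint_union_right.2 ⟨(Set.disjoint_union_left.1 hdisj).1, hd⟩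
      · exact hamC.append h₂ (Set.disjoint_union_left.1 hdisj).2.symm (by rwa [edist_comm])

theorem ConnectedOn.exists_ham (hfin : S.Finite) (hS : G.ConnectedOn S) (hu : u ∈ S)
    (hv : v ∈ S) : ∃ w, G.edist v w ≤ 1 ∧ G.Ham S u w ∧
      (S = {u} ∧ w = u ∧ v = u ∨ ∀ s ∈ S, G.Split S u w s) :=
  hS.exists_ham_of_split hu hv fun _ hw _ hs h => hS.split hfin hu hw hs h

/-! ### Filling finite sets -/

theorem ConnectedOn.exists_finite_connectedOn (hU : G.ConnectedOn U) (hF : F.Finite)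
    (hFU : F ⊆ U) (hx : x ∈ U) :
    ∃ S, S.Finite ∧ G.ConnectedOn S ∧ x ∈ S ∧ F ⊆ S ∧ S ⊆ U := by
  have key : ∀ y ∈ U, ∃ S, S.Finite ∧ G.ConnectedOn S ∧ x ∈ S ∧ y ∈ S ∧ S ⊆ U := by
    intro y hy
    have h := hU x hx y hy
    clear hy
    induction h with
    | refl => exact ⟨{x}, by simp, connectedOn_singleton x, rfl, rfl, by simpa using hx⟩
    | @tail b c _ h ih =>
      obtain ⟨S, hS, hSc, hxS, hbS, hSU⟩ := ih
      refine ⟨S ∪ {c}, hS.union (by simp), hSc.union (connectedOn_singleton c) hbS rfl (.inr h.1),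
        .inl hxS, .inr rfl, Set.union_subset hSU (by simpa using h.2.2)⟩
  induction F, hF using Set.Finite.induction_on with
  | empty => exact ⟨{x}, by simp, connectedOn_singleton x, rfl, by simp, by simpa using hx⟩
  | @insert y F _ _ ih =>
    obtain ⟨S, hS, hSc, hxS, hFS, hSU⟩ := ih ((Set.subset_insert _ _).trans hFU)
    obtain ⟨T, hT, hTc, hxT, hyT, hTU⟩ := key y (hFU (Set.mem_insert _ _))
    refine ⟨S ∪ T, hS.union hT, hSc.union hTc hxS hxT (.inl rfl), .inl hxS, ?_,
      Set.union_subset hSU hTU⟩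
    exact Set.insert_subset (.inr hyT) (hFS.trans Set.subset_union_left)

/-- Enclose `F` in a finite connected `S₀` and add all finite components of `U \ S₀`. Each of them
contains a neighbour of `S₀`, so by local finiteness there are finitely many, and adding them keeps
the set connected. -/
theorem ConnectedOn.exists_fill (hlf : ∀ v, (G.neighborSet v).Finite) (hU : G.ConnectedOn U)
    (hF : F.Finite) (hFU : F ⊆ U) (hne : F.Nonempty) :
    ∃ S, S.Finite ∧ G.ConnectedOn S ∧ F ⊆ S ∧ S ⊆ U ∧
      ∀ x ∈ U \ S, (G.componentIn (U \ S) x).Infinite := by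
  obtain ⟨r, hr⟩ := hne
  obtain ⟨S₀, hS₀, hS₀c, hrS₀, hFS₀, hS₀U⟩ := hU.exists_finite_connectedOn hF hFU (hFU hr)
  set B : Set W := {x ∈ U \ S₀ | (G.componentIn (U \ S₀) x).Finite} with hB
  have hBclosed : ∀ a b, G.Joined (U \ S₀) a b → a ∈ B → b ∈ B := fun a b hab ha =>
    ⟨hab.mem ha.1, componentIn_eq hab ▸ ha.2⟩
  have hexit : ∀ x ∈ B, ∃ y ∈ B, G.Joined B x y ∧ ∃ a ∈ S₀, G.Adj a y := by
    intro x hx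
    obtain ⟨y, hy, hxy, a, ha, hay⟩ := hU.exists_adj hS₀U ⟨r, hrS₀⟩ hx.1
    refine ⟨y, hBclosed x y hxy hx, ?_, a, ha, hay⟩
    refine (Joined.inter hxy hx fun a b ha haU hbU hab => ?_).1.mono Set.inter_subset_right
    exact hBclosed a b (.of_adj hab haU hbU) ha
  have hBfin : B.Finite := by
    have h1 : ((⋃ a ∈ S₀, G.neighborSet a) ∩ B).Finite :=
      (hS₀.biUnion fun a _ => hlf a).inter_of_left _
    refine (h1.biUnion (t := fun y => G.componentIn (U \ S₀) y) fun y hy => hy.2.2).subset ?_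
    intro x hx
    obtain ⟨y, hy, hxy, a, ha, hay⟩ := hexit x hx
    refine Set.mem_biUnion (x := y) ⟨Set.mem_biUnion ha hay, hy⟩ ?_
    exact hxy.symm.mono fun z hz => hz.1
  refine ⟨S₀ ∪ B, hS₀.union hBfin, ?_, hFS₀.trans Set.subset_union_left,
    Set.union_subset hS₀U fun x hx => hx.1.1, ?_⟩
  · refine connectedOn_of_forall r fun x hx => ?_
    rcases hx with hx | hx
    · exact (hS₀c r hrS₀ x hx).mono Set.subset_union_left
    · obtain ⟨y, hy, hxy, a, ha, hay⟩ := hexit x hx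
      exact ((hS₀c r hrS₀ a ha).mono Set.subset_union_left).trans
        ((Joined.of_adj hay (.inl ha) (.inr hy)).trans (hxy.symm.mono Set.subset_union_right))
  · intro x hx
    have hx₀ : x ∈ U \ S₀ := ⟨hx.1, fun h => hx.2 (.inl h)⟩
    have hxB : x ∉ B := fun h => hx.2 (.inr h)
    have hinf : (G.componentIn (U \ S₀) x).Infinite := fun h => hxB ⟨hx₀, h⟩
    refine hinf.mono fun y hy => ?_
    refine (Joined.inter (S := Bᶜ) hy hxB fun a b ha haU hbU hab hb => ?_).1.mono ?_
    · exact ha (hBclosed b a (.of_adj hab.symm hbU haU) hb)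
    · exact fun z hz => ⟨hz.1.1, fun h => h.elim hz.1.2 hz.2⟩

theorem componentIn_mono (hST : S ⊆ T) : G.componentIn S x ⊆ G.componentIn T x :=
  fun _ h => h.mono hST

theorem ConnectedOn.exists_infinite_componentIn (hlf : ∀ v, (G.neighborSet v).Finite)
    (hU : G.ConnectedOn U) (hinf : U.Infinite) (hK : K.Finite) :
    ∃ x ∈ U \ K, (G.componentIn (U \ K) x).Infinite := by
  obtain ⟨r, hr⟩ := hinf.nonempty
  obtain ⟨S, hS, -, hFS, hSU, hcomp⟩ := hU.exists_fill hlf (F := insert r (K ∩ U))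
    ((hK.inter_of_left U).insert r) (Set.insert_subset hr Set.inter_subset_right)
    (Set.insert_nonempty _ _)
  obtain ⟨x, hx⟩ := (hinf.sdiff hS).nonempty
  have hsub : U \ S ⊆ U \ K := fun y hy => ⟨hy.1, fun h => hy.2 (hFS (.inr ⟨h, hy.1⟩))⟩
  exact ⟨x, hsub hx, (hcomp x hx).mono (componentIn_mono hsub)⟩

/-! ### One-ended sets -/

/-- The subgraph induced on `U` is infinite, connected, and has one end. -/
structure OneEnded (G : SimpleGraph W) (U : Set W) : Prop where
  infinite : U.Infinite
  connectedOn : G.ConnectedOn U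
  joined : ∀ K : Set W, K.Finite → ∀ x ∈ U \ K, ∀ y ∈ U \ K,
    (G.componentIn (U \ K) x).Infinite → (G.componentIn (U \ K) y).Infinite →
      G.Joined (U \ K) x y

theorem OneEnded.sdiff (hU : G.OneEnded U) (hK : K.Finite) (h : G.ConnectedOn (U \ K)) :
    G.OneEnded (U \ K) where
  infinite := hU.infinite.sdiff hK
  connectedOn := h
  joined K' hK' := by
    rw [Set.sdiff_sdiff]
    exact hU.joined _ (hK.union hK')

theorem OneEnded.exists_fill (hlf : ∀ v, (G.neighborSet v).Finite) (hU : G.OneEnded U)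
    (hF : F.Finite) (hFU : F ⊆ U) (hne : F.Nonempty) :
    ∃ S, S.Finite ∧ G.ConnectedOn S ∧ F ⊆ S ∧ S ⊆ U ∧ G.OneEnded (U \ S) ∧
      ∃ s ∈ S, ∃ x ∈ U \ S, G.Adj s x := by
  obtain ⟨S, hS, hSc, hFS, hSU, hcomp⟩ := hU.connectedOn.exists_fill hlf hF hFU hne
  refine ⟨S, hS, hSc, hFS, hSU, hU.sdiff hS fun x hx y hy =>
    hU.joined S hS x hx y hy (hcomp x hx) (hcomp y hy), ?_⟩
  obtain ⟨x, hx⟩ := (hU.infinite.sdiff hS).nonempty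
  obtain ⟨z, hz, -, a, ha, haz⟩ := hU.connectedOn.exists_adj hSU (hne.mono hFS) hx
  exact ⟨a, ha, z, hz, haz⟩

theorem OneEnded.exists_adj (hU : G.OneEnded U) (hx : x ∈ U) : ∃ y ∈ U, G.Adj x y := by
  obtain ⟨y, hy, hyx⟩ := hU.infinite.exists_notMem_finite (Set.finite_singleton x)
  exact hU.connectedOn.exists_adj_self hx hy fun h => hyx h.symm

/-- In a one-ended set, a path arriving near `u` can be extended to cover a given finite set. -/
theorem OneEnded.exists_ham (hlf : ∀ v, (G.neighborSet v).Finite) (hU : G.OneEnded U)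
    (hF : F.Finite) (hFU : F ⊆ U) (hu : u ∈ U) :
    ∃ S a u', F ⊆ S ∧ S ⊆ U ∧ G.Ham S u a ∧ G.OneEnded (U \ S) ∧ u' ∈ U \ S ∧
      G.edist a u' ≤ 3 := by
  obtain ⟨S, hS, hSc, hFS, hSU, hone, s, hs, x, hx, hsx⟩ :=
    hU.exists_fill hlf (hF.insert u) (Set.insert_subset hu hFU) (Set.insert_nonempty _ _)
  obtain ⟨a, hsa, ham, -⟩ := hSc.exists_ham hS (hFS (Set.mem_insert _ _)) hs
  refine ⟨S, a, x, (Set.subset_insert _ _).trans hFS, hSU, ham, hone, hx, ?_⟩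
  exact (edist_le_add (edist_le_symm hsa) (edist_le_one_of_adj hsx)).trans (by norm_num)

/-- In a one-ended set, a path arriving near `u` on one side and near `v` on the other can be
extended at both ends to cover a given finite set. -/
theorem OneEnded.exists_ham_pair (hlf : ∀ v, (G.neighborSet v).Finite) (hU : G.OneEnded U)
    (hF : F.Finite) (hFU : F ⊆ U) (hu : u ∈ U) (hv : v ∈ U) (huv : u ≠ v) :
    ∃ T₁ T₂ a b u' v', F ⊆ T₁ ∪ T₂ ∧ T₁ ∪ T₂ ⊆ U ∧ Disjoint T₁ T₂ ∧ G.Ham T₁ u a ∧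
      G.Ham T₂ v b ∧ G.OneEnded (U \ (T₁ ∪ T₂)) ∧ u' ∈ U \ (T₁ ∪ T₂) ∧
      v' ∈ U \ (T₁ ∪ T₂) ∧ u' ≠ v' ∧ G.edist a u' ≤ 3 ∧ G.edist b v' ≤ 3 := by
  obtain ⟨S, hS, hSc, hFS, hSU, hone, s, hs, x, hx, hsx⟩ :=
    hU.exists_fill hlf ((hF.insert v).insert u)
      (Set.insert_subset hu (Set.insert_subset hv hFU)) (Set.insert_nonempty _ _)
  obtain ⟨x', hx', hxx'⟩ := hone.exists_adj hx
  have hFS' : F ⊆ S :=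
    ((Set.subset_insert _ _).trans (Set.subset_insert _ _)).trans hFS
  obtain ⟨T₁, T₂, a, b, rfl, hd, h₁, h₂, hab, hs'⟩ :=
    hSc.split hS (hFS (Set.mem_insert _ _)) (hFS (Set.mem_insert_of_mem _ (Set.mem_insert _ _)))
      hs huv
  have h1 : G.edist s x' ≤ 3 := (edist_le_add (edist_le_one_of_adj hsx)
    (edist_le_one_of_adj hxx')).trans (by norm_num)
  -- The half ending at `s` continues to `x'`, at distance at most 2 through `x`; the other half
  -- continues to `x`, at distance at most 2 + 1.
  rcases hs' with rfl | rfl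
  · refine ⟨T₁, T₂, s, b, x', x, hFS', hSU, hd, h₁, h₂, hone, hx', hx, hxx'.ne.symm, h1, ?_⟩
    exact (edist_le_add (edist_le_symm hab) (edist_le_one_of_adj hsx)).trans
      (by norm_num)
  · refine ⟨T₁, T₂, a, s, x, x', hFS', hSU, hd, h₁, h₂, hone, hx, hx', hxx'.ne, ?_, h1⟩
    exact (edist_le_add hab (edist_le_one_of_adj hsx)).trans (by norm_num)

end SimpleGraph

namespace SimpleGraph

variable {W : Type*} {G : SimpleGraph W} {N L S T U K F : Set W} {a b c s u v x y z : W}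

/-! ### Two-ended sets -/

/-- The subgraph induced on `N` is infinite, connected, and has two ends, which are separated by
the finite set `K`. -/
structure TwoEnded (G : SimpleGraph W) (N K : Set W) : Prop where
  infinite : N.Infinite
  connectedOn : G.ConnectedOn N
  separated : ∃ a ∈ N \ K, ∃ b ∈ N \ K, (G.componentIn (N \ K) a).Infinite ∧
    (G.componentIn (N \ K) b).Infinite ∧ ¬ G.Joined (N \ K) a b
  joined : ∀ K : Set W, K.Finite → ∀ x ∈ N \ K, ∀ y ∈ N \ K, ∀ z ∈ N \ K,
    (G.componentIn (N \ K) x).Infinite → (G.componentIn (N \ K) y).Infinite →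
      (G.componentIn (N \ K) z).Infinite →
        G.Joined (N \ K) x y ∨ G.Joined (N \ K) x z ∨ G.Joined (N \ K) y z

/-- Each infinite component of `N \ K` still has an infinite component after the finite set `L` is
removed, and vertices of different components stay separated. -/
theorem TwoEnded.separated_of_subset (hlf : ∀ v, (G.neighborSet v).Finite) (h : G.TwoEnded N K)
    (hL : L.Finite) (hKL : K ⊆ L) :
    ∃ a ∈ N \ L, ∃ b ∈ N \ L, (G.componentIn (N \ L) a).Infinite ∧
      (G.componentIn (N \ L) b).Infinite ∧ ¬ G.Joined (N \ L) a b := by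
  have key : ∀ a ∈ N \ K, (G.componentIn (N \ K) a).Infinite →
      ∃ a' ∈ N \ L, (G.componentIn (N \ L) a').Infinite ∧ G.Joined (N \ K) a a' := by
    intro a ha hinf
    obtain ⟨a', ha', hinf'⟩ := connectedOn_componentIn.exists_infinite_componentIn hlf hinf hL
    have hsub : G.componentIn (N \ K) a \ L ⊆ N \ L :=
      fun x hx => ⟨(componentIn_subset ha hx.1).1, hx.2⟩
    exact ⟨a', hsub ha', hinf'.mono (componentIn_mono hsub), ha'.1⟩
  obtain ⟨a, ha, b, hb, hainf, hbinf, hab⟩ := h.separated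
  obtain ⟨a', ha', hainf', haa'⟩ := key a ha hainf
  obtain ⟨b', hb', hbinf', hbb'⟩ := key b hb hbinf
  refine ⟨a', ha', b', hb', hainf', hbinf', fun h' => hab ?_⟩
  exact haa'.trans ((h'.mono (Set.sdiff_subset_sdiff_right hKL)).trans hbb'.symm)

/-- Two infinite pieces of the component of `u`, together with one inside the component of `v`, give
three infinite components; two of them must coincide, and the one on the side of `v` cannot be
involved. -/
theorem TwoEnded.oneEnded_componentIn (hlf : ∀ v, (G.neighborSet v).Finite)
    (h : G.TwoEnded N K) (hL : L.Finite) (hu : u ∈ N \ L) (hv : v ∈ N \ L)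
    (huinf : (G.componentIn (N \ L) u).Infinite) (hvinf : (G.componentIn (N \ L) v).Infinite)
    (huv : ¬ G.Joined (N \ L) u v) : G.OneEnded (G.componentIn (N \ L) u) where
  infinite := huinf
  connectedOn := connectedOn_componentIn
  joined M hM x hx y hy hxinf hyinf := by
    obtain ⟨z, hz, hzinf⟩ := connectedOn_componentIn.exists_infinite_componentIn hlf hvinf hM
    have hsub : ∀ w ∈ N \ L, G.componentIn (N \ L) w \ M ⊆ N \ (L ∪ M) := fun w hw t ht =>
      ⟨(componentIn_subset hw ht.1).1, fun h => h.elim (componentIn_subset hw ht.1).2 ht.2⟩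
    have hsub' : N \ (L ∪ M) ⊆ N \ L := Set.sdiff_subset_sdiff_right Set.subset_union_left
    rcases h.joined (L ∪ M) (hL.union hM) x (hsub u hu hx) y (hsub u hu hy) z (hsub v hv hz)
      (hxinf.mono (componentIn_mono (hsub u hu))) (hyinf.mono (componentIn_mono (hsub u hu)))
      (hzinf.mono (componentIn_mono (hsub v hv))) with hxy | hxz | hyz
    · refine (Joined.inter hxy hx.1 fun a b ha haU hbU hab => ?_).1.mono
        fun t ht => ⟨ht.2, fun htM => ht.1.2 (.inr htM)⟩
      exact Joined.trans ha (.of_adj hab (hsub' haU) (hsub' hbU))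
    · exact (huv (Joined.trans hx.1 ((hxz.mono hsub').trans (Joined.symm hz.1)))).elim
    · exact (huv (Joined.trans hy.1 ((hyz.mono hsub').trans (Joined.symm hz.1)))).elim

/-- Every vertex of `U` is joined within `U` to one of the vertices `u ≠ v` of `U`, and these are
joined to each other if `one` holds. -/
structure Covers (G : SimpleGraph W) (one : Prop) (U : Set W) (u v : W) : Prop where
  left_mem : u ∈ U
  right_mem : v ∈ U
  ne : u ≠ v
  joined : ∀ x ∈ U, G.Joined U u x ∨ G.Joined U v x
  joined_of_one : one → G.Joined U u v

/-- `Covers` allows at most the components of `u` and `v`, while there are at least two infinite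
ones because `L` contains `K`. So these two are distinct and infinite, although `Covers` mentions no
infinitude. -/
theorem TwoEnded.oneEnded_of_covers {one : Prop} (hlf : ∀ v, (G.neighborSet v).Finite)
    (h : G.TwoEnded N K) (hL : L.Finite) (hKL : K ⊆ L) (hc : G.Covers one (N \ L) u v) :
    G.OneEnded (G.componentIn (N \ L) u) ∧ G.OneEnded (G.componentIn (N \ L) v) ∧
      ¬ G.Joined (N \ L) u v := by
  obtain ⟨a, ha, b, hb, hainf, hbinf, hab⟩ := h.separated_of_subset hlf hL hKL
  have key : (G.componentIn (N \ L) u).Infinite ∧ (G.componentIn (N \ L) v).Infinite ∧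
      ¬ G.Joined (N \ L) u v := by
    rcases hc.joined a ha with hua | hva <;> rcases hc.joined b hb with hub | hvb
    · exact (hab (hua.symm.trans hub)).elim
    · rw [componentIn_eq hua, componentIn_eq hvb]
      exact ⟨hainf, hbinf, fun h => hab (hua.symm.trans (h.trans hvb))⟩
    · rw [componentIn_eq hub, componentIn_eq hva]
      exact ⟨hbinf, hainf, fun h => hab (hva.symm.trans (h.symm.trans hub))⟩
    · exact (hab (hva.symm.trans hvb)).elim
  exact ⟨h.oneEnded_componentIn hlf hL hc.left_mem hc.right_mem key.1 key.2.1 key.2.2,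
    h.oneEnded_componentIn hlf hL hc.right_mem hc.left_mem key.2.1 key.1
      fun h => key.2.2 h.symm, key.2.2⟩

/-- `N` is one-ended or two-ended, according to `one`; in the second case the finite set `K`
separates the ends. -/
def EndsAs (G : SimpleGraph W) (one : Prop) (N K : Set W) : Prop :=
  one ∧ G.OneEnded N ∨ ¬ one ∧ G.TwoEnded N K

theorem EndsAs.connectedOn {one : Prop} (h : G.EndsAs one N K) : G.ConnectedOn N := by
  rcases h with h | h
  · exact h.2.connectedOn
  · exact h.2.connectedOn

theorem EndsAs.infinite {one : Prop} (h : G.EndsAs one N K) : N.Infinite := by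
  rcases h with h | h
  · exact h.2.infinite
  · exact h.2.infinite

/-- A pair of paths arriving near `u` and `v` extends to cover a given finite set of free
vertices. -/
theorem EndsAs.exists_extension {one : Prop} (hlf : ∀ v, (G.neighborSet v).Finite)
    (h : G.EndsAs one N K) (hL : L.Finite) (hKL : K ⊆ L) (hc : G.Covers one (N \ L) u v)
    (hF : F.Finite) (hFU : F ⊆ N \ L) :
    ∃ T₁ T₂ a b u' v', F ⊆ T₁ ∪ T₂ ∧ T₁ ∪ T₂ ⊆ N \ L ∧ Disjoint T₁ T₂ ∧ G.Ham T₁ u a ∧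
      G.Ham T₂ v b ∧ G.edist a u' ≤ 3 ∧ G.edist b v' ≤ 3 ∧
      G.Covers one ((N \ L) \ (T₁ ∪ T₂)) u' v' := by
  rcases h with ⟨hone, h⟩ | ⟨hone, h⟩
  · have hU : G.OneEnded (N \ L) := by
      refine h.sdiff hL (connectedOn_of_forall u fun x hx => ?_)
      exact (hc.joined x hx).elim id fun h => (hc.joined_of_one hone).trans h
    obtain ⟨T₁, T₂, a, b, u', v', hFT, hTU, hd, h₁, h₂, hT, hu', hv', hne, hau, hbv⟩ :=
      hU.exists_ham_pair hlf hF hFU hc.left_mem hc.right_mem hc.ne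
    exact ⟨T₁, T₂, a, b, u', v', hFT, hTU, hd, h₁, h₂, hau, hbv, hu', hv', hne,
      fun x hx => .inl (hT.connectedOn _ hu' _ hx), fun _ => hT.connectedOn _ hu' _ hv'⟩
  · obtain ⟨hA, hB, huv⟩ := h.oneEnded_of_covers hlf hL hKL hc
    set A := G.componentIn (N \ L) u with hAdef
    set B := G.componentIn (N \ L) v with hBdef
    have hAU : A ⊆ N \ L := componentIn_subset hc.left_mem
    have hBU : B ⊆ N \ L := componentIn_subset hc.right_mem
    have hAB : Disjoint A B := Set.disjoint_left.2 fun x hx hx' =>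
      huv (Joined.trans hx (Joined.symm hx'))
    obtain ⟨T₁, a, u', hF₁, hT₁, h₁, hone₁, hu', hau⟩ := hA.exists_ham hlf (F := F ∩ A)
      (hF.inter_of_left A) Set.inter_subset_right (mem_componentIn_self (x := u))
    obtain ⟨T₂, b, v', hF₂, hT₂, h₂, hone₂, hv', hbv⟩ := hB.exists_ham hlf (F := F ∩ B)
      (hF.inter_of_left B) Set.inter_subset_right (mem_componentIn_self (x := v))
    have hsubA : A \ T₁ ⊆ (N \ L) \ (T₁ ∪ T₂) := fun x hx =>
      ⟨hAU hx.1, fun h => h.elim hx.2 fun h => Set.disjoint_left.1 hAB hx.1 (hT₂ h)⟩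
    have hsubB : B \ T₂ ⊆ (N \ L) \ (T₁ ∪ T₂) := fun x hx =>
      ⟨hBU hx.1, fun h => h.elim (fun h => Set.disjoint_left.1 hAB (hT₁ h) hx.1) hx.2⟩
    refine ⟨T₁, T₂, a, b, u', v', fun x hx => ?_, Set.union_subset (hT₁.trans hAU)
      (hT₂.trans hBU), hAB.mono hT₁ hT₂, h₁, h₂, hau, hbv, hsubA hu', hsubB hv', ?_,
      fun x hx => ?_, fun h => (hone h).elim⟩
    · exact (hc.joined x (hFU hx)).imp (fun h => hF₁ ⟨hx, h⟩) fun h => hF₂ ⟨hx, h⟩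
    · rintro rfl
      exact Set.disjoint_left.1 hAB hu'.1 hv'.1
    · refine (hc.joined x hx.1).imp (fun h => ?_) fun h => ?_
      · exact (hone₁.connectedOn _ hu' _ ⟨h, fun h => hx.2 (.inl h)⟩).mono hsubA
      · exact (hone₂.connectedOn _ hv' _ ⟨h, fun h => hx.2 (.inr h)⟩).mono hsubB

/-- The halves are listed from the middle outwards. With one end, start from an edge and grow on
both sides. With two ends, run a Hamiltonian path of a finite set containing `K` between vertices
next to the two infinite components, cut it, and reverse both halves. -/
theorem EndsAs.exists_initial {one : Prop} (hlf : ∀ v, (G.neighborSet v).Finite)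
    (h : G.EndsAs one N K) (hK : K.Finite) (hKN : K ⊆ N) :
    ∃ T₁ T₂ a₀ b₀ a b u v, K ⊆ T₁ ∪ T₂ ∧ T₁ ∪ T₂ ⊆ N ∧ Disjoint T₁ T₂ ∧ G.edist a₀ b₀ ≤ 3 ∧
      G.Ham T₁ a₀ a ∧ G.Ham T₂ b₀ b ∧ G.edist a u ≤ 3 ∧ G.edist b v ≤ 3 ∧
      G.Covers one (N \ (T₁ ∪ T₂)) u v := by
  rcases h with ⟨hone, h⟩ | ⟨hone, h⟩
  · obtain ⟨x, hx⟩ := h.infinite.nonempty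
    obtain ⟨y, hy, hxy⟩ := h.exists_adj hx
    obtain ⟨T₁, T₂, a, b, u', v', hFT, hTU, hd, h₁, h₂, hT, hu', hv', hne, hau, hbv⟩ :=
      h.exists_ham_pair hlf hK hKN hx hy hxy.ne
    exact ⟨T₁, T₂, x, y, a, b, u', v', hFT, hTU, hd,
      (edist_le_one_of_adj hxy).trans (by norm_num), h₁, h₂, hau, hbv, hu', hv', hne,
      fun x hx => .inl (hT.connectedOn _ hu' _ hx), fun _ => hT.connectedOn _ hu' _ hv'⟩
  · obtain ⟨x, hx⟩ := h.infinite.nonempty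
    obtain ⟨y, hy, hyx⟩ := h.infinite.exists_notMem_finite (Set.finite_singleton x)
    -- Two distinct vertices are forced into `S` so that its path has a jump at which to cut.
    obtain ⟨S, hS, hSc, hFS, hSN, hcomp⟩ := h.connectedOn.exists_fill hlf
      ((hK.insert y).insert x) (Set.insert_subset hx (Set.insert_subset hy hKN))
      (Set.insert_nonempty _ _)
    have hxS : x ∈ S := hFS (Set.mem_insert _ _)
    have hyS : y ∈ S := hFS (Set.mem_insert_of_mem _ (Set.mem_insert _ _))
    have hKS : K ⊆ S := ((Set.subset_insert _ _).trans (Set.subset_insert _ _)).trans hFS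
    obtain ⟨a', ha', b', hb', hainf, hbinf, hab⟩ := h.separated_of_subset hlf hS hKS
    obtain ⟨u, hu, hau, s, hs, hsu⟩ := h.connectedOn.exists_adj hSN ⟨x, hxS⟩ ha'
    obtain ⟨v, hv, hbv, t, ht, htv⟩ := h.connectedOn.exists_adj hSN ⟨x, hxS⟩ hb'
    obtain ⟨w, htw, -, hsplit⟩ := hSc.exists_ham hS hs ht
    have hsplit : G.Split S s w s := by
      rcases hsplit with ⟨rfl, -⟩ | hsplit
      · exact (hyx (by rw [Set.mem_singleton_iff] at hxS hyS ⊢; rw [hxS, hyS])).elim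
      · exact hsplit s hs
    obtain ⟨T₁, T₂, a, b, rfl, hd, h₁, h₂, hab', -⟩ := hsplit
    refine ⟨T₁, T₂, a, b, s, w, u, v, hKS, hSN, hd, hab'.trans (by norm_num), h₁.symm,
      h₂.symm, (edist_le_one_of_adj hsu).trans (by norm_num),
      (edist_le_add (edist_le_symm htw) (edist_le_one_of_adj htv)).trans (by norm_num),
      hu, hv, ?_, fun z hz => ?_, fun h => (hone h).elim⟩
    · rintro rfl
      exact hab (hau.trans hbv.symm)
    · rcases h.joined _ hS a' ha' b' hb' z hz hainf hbinf (hcomp z hz) with h | h | h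
      · exact (hab h).elim
      · exact .inl (hau.symm.trans h)
      · exact .inr (hbv.symm.trans h)

/-- It suffices to check `Covers` at the boundary. -/
theorem ConnectedOn.covers_of_boundary {one : Prop} (hN : G.ConnectedOn N) (hLN : L ⊆ N)
    (hL : L.Nonempty) (hu : u ∈ N \ L) (hv : v ∈ N \ L) (huv : u ≠ v)
    (h : ∀ a ∈ L, ∀ y ∈ N \ L, G.Adj a y → G.Joined (N \ L) u y ∨ G.Joined (N \ L) v y)
    (h' : one → G.Joined (N \ L) u v) : G.Covers one (N \ L) u v where
  left_mem := hu
  right_mem := hv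
  ne := huv
  joined x hx := by
    obtain ⟨z, hz, hxz, a, ha, haz⟩ := hN.exists_adj hLN hL hx
    exact (h a ha z hz haz).imp (fun h => h.trans hxz.symm) fun h => h.trans hxz.symm
  joined_of_one := h'

end SimpleGraph

/-! ### Semidecidable predicates, their closure properties and uniformization. -/

/-- A predicate is of the form `∃ k, q a k` with `q` primitive recursive. -/
def SigmaOne {α : Type*} [Primcodable α] (p : α → Prop) : Prop :=
  ∃ q : α → ℕ → Bool, Primrec₂ q ∧ ∀ a, p a ↔ ∃ k, q a k = true

namespace SigmaOne

variable {α β γ : Type*} [Primcodable α] [Primcodable β] [Primcodable γ]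

theorem of_eq {p p' : α → Prop} (h : SigmaOne p) (H : ∀ a, p a ↔ p' a) : SigmaOne p' :=
  (funext fun a => propext (H a) : p = p') ▸ h

theorem of_primrec {p : α → Prop} (h : PrimrecPred p) : SigmaOne p := by
  obtain ⟨_, h⟩ := h
  exact ⟨fun a _ => decide (p a), (h.comp Primrec.fst).to₂, fun a => by simp⟩

theorem comp {p : β → Prop} (h : SigmaOne p) {f : α → β} (hf : Primrec f) :
    SigmaOne fun a => p (f a) := by
  obtain ⟨q, hq, hp⟩ := h
  exact ⟨fun a k => q (f a) k, hq.comp (hf.comp Primrec.fst) Primrec.snd, fun a => hp (f a)⟩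

theorem and {p p' : α → Prop} (h : SigmaOne p) (h' : SigmaOne p') :
    SigmaOne fun a => p a ∧ p' a := by
  obtain ⟨q, hq, hp⟩ := h
  obtain ⟨q', hq', hp'⟩ := h'
  refine ⟨fun a k => q a k.unpair.1 && q' a k.unpair.2, ?_, fun a => ?_⟩
  · exact Primrec.and.comp
      (hq.comp Primrec.fst (Primrec.fst.comp (Primrec.unpair.comp Primrec.snd)))
      (hq'.comp Primrec.fst (Primrec.snd.comp (Primrec.unpair.comp Primrec.snd)))
  · beta_reduce
    rw [hp, hp']
    constructor
    · rintro ⟨⟨k, hk⟩, l, hl⟩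
      exact ⟨Nat.pair k l, by simp [hk, hl]⟩
    · rintro ⟨k, hk⟩
      rw [Bool.and_eq_true] at hk
      exact ⟨⟨_, hk.1⟩, _, hk.2⟩

theorem or {p p' : α → Prop} (h : SigmaOne p) (h' : SigmaOne p') :
    SigmaOne fun a => p a ∨ p' a := by
  obtain ⟨q, hq, hp⟩ := h
  obtain ⟨q', hq', hp'⟩ := h'
  refine ⟨fun a k => q a k || q' a k, Primrec.or.comp hq hq', fun a => ?_⟩
  beta_reduce
  rw [hp, hp', ← exists_or]
  simp

theorem exists' {p : α → β → Prop} (h : SigmaOne fun x : α × β => p x.1 x.2) :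
    SigmaOne fun a => ∃ b, p a b := by
  obtain ⟨q, hq, hp⟩ := h
  refine ⟨fun a k => Option.casesOn (motive := fun _ => Bool) (Encodable.decode (α := β) k.unpair.1)
    false fun b => q (a, b) k.unpair.2, ?_, fun a => ?_⟩
  · refine Primrec.option_casesOn
      (Primrec.decode.comp (Primrec.fst.comp (Primrec.unpair.comp Primrec.snd)))
      (Primrec.const false) ?_
    exact hq.comp (Primrec.pair (Primrec.fst.comp Primrec.fst) Primrec.snd)
      (Primrec.snd.comp (Primrec.unpair.comp (Primrec.snd.comp Primrec.fst)))
  · constructor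
    · rintro ⟨b, hb⟩
      obtain ⟨k, hk⟩ := (hp (a, b)).1 hb
      exact ⟨Nat.pair (Encodable.encode b) k, by simp [hk]⟩
    · rintro ⟨k, hk⟩
      cases hd : Encodable.decode (α := β) k.unpair.1 with
      | none => simp [hd] at hk
      | some b => exact ⟨b, (hp (a, b)).2 ⟨_, by simpa [hd] using hk⟩⟩

theorem forall_mem {p : α → β → Prop} (h : SigmaOne fun x : α × β => p x.1 x.2) {l : α → List β}
    (hl : Primrec l) : SigmaOne fun a => ∀ b ∈ l a, p a b := by
  obtain ⟨q, hq, hp⟩ := h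
  have h0 : PrimrecRel fun (j : ℕ) (x : α × β) => q x j = true :=
    Primrec.eq.comp (hq.comp Primrec.snd Primrec.fst) (Primrec.const true)
  have h1 : PrimrecRel fun (b : β) (y : α × ℕ) =>
      ∃ j ∈ List.range y.2, q (y.1, b) j = true :=
    PrimrecRel.comp (f := fun z : β × α × ℕ => List.range z.2.2)
      (g := fun z : β × α × ℕ => (z.2.1, z.1))
      h0.exists_mem_list (Primrec.list_range.comp <| Primrec.snd.comp Primrec.snd)
      (Primrec.pair (Primrec.fst.comp Primrec.snd) Primrec.fst)
  have h2 : PrimrecPred fun y : α × ℕ => ∀ b ∈ l y.1, ∃ j ∈ List.range y.2, q (y.1, b) j = true :=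
    h1.forall_mem_list.comp (hl.comp Primrec.fst) Primrec.id
  obtain ⟨_, h3⟩ := h2
  refine ⟨fun a k => decide (∀ b ∈ l a, ∃ j < k, q (a, b) j = true),
    h3.of_eq fun _ => by simp,
    fun a => ?_⟩
  simp only [decide_eq_true_eq]
  constructor
  · intro H
    have : ∀ b ∈ l a, ∃ k, ∃ j < k, q (a, b) j = true := fun b hb => by
      obtain ⟨j, hj⟩ := (hp (a, b)).1 (H b hb)
      exact ⟨j + 1, j, j.lt_succ_self, hj⟩
    choose! k hk using this
    -- One search bound must serve all members of the list; the sum of the individual bounds does.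
    refine ⟨((l a).map k).sum, fun b hb => ?_⟩
    obtain ⟨j, hj, hj'⟩ := hk b hb
    exact ⟨j, hj.trans_le (List.single_le_sum (by simp) _ (List.mem_map_of_mem hb)), hj'⟩
  · rintro ⟨k, hk⟩ b hb
    obtain ⟨j, -, hj⟩ := hk b hb
    exact (hp (a, b)).2 ⟨j, hj⟩

/-- Evaluation of a code within `k` steps is primitive recursive in `k`, so a search over `k`
confirms a value. -/
theorem graph {f : α → β} (hf : Computable f) : SigmaOne fun x : α × β => f x.1 = x.2 := by
  obtain ⟨c, hc⟩ := Nat.Partrec.Code.exists_code.1 hf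
  refine ⟨fun x k => decide (Nat.Partrec.Code.evaln k c (Encodable.encode x.1) =
    some (Encodable.encode x.2)), ?_, fun x => ?_⟩
  · have h : PrimrecPred fun y : (α × β) × ℕ => Nat.Partrec.Code.evaln y.2 c
        (Encodable.encode y.1.1) = some (Encodable.encode y.1.2) :=
      Primrec.eq.comp (Nat.Partrec.Code.primrec_evaln.comp
        (Primrec.pair (Primrec.pair Primrec.snd (Primrec.const c))
          (Primrec.encode.comp (Primrec.fst.comp Primrec.fst))))
        (Primrec.option_some.comp (Primrec.encode.comp (Primrec.snd.comp Primrec.fst)))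
    obtain ⟨_, h⟩ := h
    exact h.of_eq fun _ => by simp
  · beta_reduce
    have h : Encodable.encode x.2 ∈ c.eval (Encodable.encode x.1) ↔ f x.1 = x.2 := by
      rw [hc]
      simp [eq_comm]
    rw [← h, Nat.Partrec.Code.evaln_complete]
    simp

theorem eq {f g : α → β} (hf : Primrec f) (hg : Primrec g) : SigmaOne fun a => f a = g a := by
  classical
  have h : PrimrecPred fun a => Encodable.encode (f a) = Encodable.encode (g a) :=
    Primrec.eq.comp (Primrec.encode.comp hf) (Primrec.encode.comp hg)
  exact (of_primrec h).of_eq fun a => Encodable.encode_inj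

theorem isChain {R : α → β → β → Prop} (h : SigmaOne fun x : (α × β) × β => R x.1.1 x.1.2 x.2)
    {l : α → List β} (hl : Primrec l) : SigmaOne fun a => (l a).IsChain (R a) := by
  have h1 : SigmaOne fun x : α × ℕ => (l x.1)[x.2 + 1]? = none ∨
      ∃ b, ∃ c, ((l x.1)[x.2]? = some b ∧ (l x.1)[x.2 + 1]? = some c) ∧ R x.1 b c := by
    have hl' := hl.comp (Primrec.fst (α := α) (β := ℕ))
    refine (eq (Primrec.list_getElem?.comp hl' (Primrec.succ.comp Primrec.snd))
      (Primrec.const none)).or (exists' (exists' ?_))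
    refine ((eq ?_ ?_).and (eq ?_ ?_)).and ?_
    · exact Primrec.list_getElem?.comp (hl'.comp (Primrec.fst.comp Primrec.fst))
        (Primrec.snd.comp (Primrec.fst.comp Primrec.fst))
    · exact Primrec.option_some.comp (Primrec.snd.comp Primrec.fst)
    · exact Primrec.list_getElem?.comp (hl'.comp (Primrec.fst.comp Primrec.fst))
        (Primrec.succ.comp (Primrec.snd.comp (Primrec.fst.comp Primrec.fst)))
    · exact Primrec.option_some.comp Primrec.snd
    · exact h.comp (Primrec.pair (Primrec.pair (Primrec.fst.comp (Primrec.fst.comp Primrec.fst))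
        (Primrec.snd.comp Primrec.fst)) Primrec.snd)
  have h2 := h1.forall_mem (p := fun a i => (l a)[i + 1]? = none ∨
      ∃ b, ∃ c, ((l a)[i]? = some b ∧ (l a)[i + 1]? = some c) ∧ R a b c)
      (Primrec.list_range.comp (Primrec.list_length.comp hl))
  refine h2.of_eq fun a => ?_
  rw [List.isChain_iff_getElem]
  constructor
  · intro H i hi
    rcases H i (List.mem_range.2 (by omega)) with H | ⟨b, c, ⟨hb, hc⟩, H⟩
    · rw [List.getElem?_eq_none_iff] at H; omega
    · rw [List.getElem?_eq_some_iff] at hb hc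
      obtain ⟨_, rfl⟩ := hb
      obtain ⟨_, rfl⟩ := hc
      exact H
  · intro H i _
    by_cases hi' : i + 1 < (l a).length
    · exact .inr ⟨_, _, ⟨List.getElem?_eq_getElem (by omega), List.getElem?_eq_getElem hi'⟩,
        H i hi'⟩
    · exact .inl (List.getElem?_eq_none (by omega))

theorem reflTransGen {R : α → β → β → Prop}
    (h : SigmaOne fun x : (α × β) × β => R x.1.1 x.1.2 x.2) {f g : α → β} (hf : Primrec f)
    (hg : Primrec g) : SigmaOne fun a => Relation.ReflTransGen (R a) (f a) (g a) := by
  have h1 : SigmaOne fun a => ∃ l : List β,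
      (f a :: l).IsChain (R a) ∧ (f a :: l).reverse.head? = some (g a) := by
    refine exists' (and (isChain (R := fun x : α × List β => R x.1) ?_ ?_) (eq ?_ ?_))
    · exact h.comp (Primrec.pair (Primrec.pair
        (Primrec.fst.comp (Primrec.fst.comp (Primrec.fst))) (Primrec.snd.comp Primrec.fst))
        Primrec.snd)
    · exact Primrec.list_cons.comp (hf.comp Primrec.fst) Primrec.snd
    · exact Primrec.list_head?.comp (Primrec.list_reverse.comp
        (Primrec.list_cons.comp (hf.comp Primrec.fst) Primrec.snd))
    · exact Primrec.option_some.comp (hg.comp Primrec.fst)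
  refine h1.of_eq fun a => ?_
  constructor
  · rintro ⟨l, hl, hg⟩
    rw [List.head?_reverse, List.getLast?_eq_some_getLast (by simp), Option.some.injEq] at hg
    rw [← hg]
    exact List.relationReflTransGen_of_exists_isChain_cons l hl rfl
  · intro H
    obtain ⟨l, hl, hg⟩ := List.exists_isChain_cons_of_relationReflTransGen H
    exact ⟨l, hl, by rw [List.head?_reverse, List.getLast?_eq_some_getLast (by simp), hg]⟩

theorem mem_list {f : α → β} {l : α → List β} (hf : Primrec f) (hl : Primrec l) :
    SigmaOne fun a => f a ∈ l a := by
  have h : SigmaOne fun a => ∃ i : ℕ, (l a)[i]? = some (f a) :=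
    exists' (eq (Primrec.list_getElem?.comp (hl.comp Primrec.fst) Primrec.snd)
      (Primrec.option_some.comp (hf.comp Primrec.fst)))
  exact h.of_eq fun a => List.mem_iff_getElem?.symm

theorem ne {f g : α → β} (hf : Primrec f) (hg : Primrec g) : SigmaOne fun a => f a ≠ g a := by
  have h : PrimrecPred fun a => Encodable.encode (f a) = Encodable.encode (g a) :=
    Primrec.eq.comp (Primrec.encode.comp hf) (Primrec.encode.comp hg)
  exact (of_primrec h.not).of_eq fun a => Encodable.encode_inj.not

theorem notMem_list {f : α → β} {l : α → List β} (hf : Primrec f) (hl : Primrec l) :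
    SigmaOne fun a => f a ∉ l a := by
  have h : SigmaOne fun a => ∀ b ∈ l a, f a ≠ b :=
    forall_mem (p := fun a b => f a ≠ b) (ne (hf.comp Primrec.fst) Primrec.snd) hl
  exact h.of_eq fun a => ⟨fun H hmem => H _ hmem rfl, fun H b hb hab => H (hab ▸ hb)⟩

theorem nodup {l : α → List β} (hl : Primrec l) : SigmaOne fun a => (l a).Nodup := by
  have h : SigmaOne fun a => ∀ i ∈ List.range (l a).length, ∀ j ∈ List.range i,
      (l a)[j]? ≠ (l a)[i]? := by
    refine forall_mem (p := fun a i => ∀ j ∈ List.range i, (l a)[j]? ≠ (l a)[i]?)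
      (forall_mem (p := fun (x : α × ℕ) j => (l x.1)[j]? ≠ (l x.1)[x.2]?) (ne ?_ ?_)
        (Primrec.list_range.comp Primrec.snd))
      (Primrec.list_range.comp (Primrec.list_length.comp hl))
    · exact Primrec.list_getElem?.comp (hl.comp (Primrec.fst.comp Primrec.fst)) Primrec.snd
    · exact Primrec.list_getElem?.comp (hl.comp (Primrec.fst.comp Primrec.fst))
        (Primrec.snd.comp Primrec.fst)
  refine h.of_eq fun a => ?_
  simp only [List.mem_range]
  rw [List.nodup_iff_getElem?_ne_getElem?]
  exact ⟨fun H i j hij hj => H j hj i hij, fun H i hi j hij => H j i hij hi⟩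

theorem const (P : Prop) : SigmaOne fun _ : α => P := by
  classical
  exact ⟨fun _ _ => decide P, Primrec₂.const _, by simp⟩

/-- `P` does not depend on the input, so its truth value is a constant of the algorithm and need not
be decidable. -/
theorem imp_const {P : Prop} {p : α → Prop} (h : SigmaOne p) : SigmaOne fun a => P → p a := by
  by_cases hP : P
  · exact h.of_eq fun a => by simp [hP]
  · exact (const True).of_eq fun a => by simp [hP]

/-- Uniformization: a partial recursive function selects values of a semidecidable relation. -/
theorem exists_partrec {p : α → β → Prop} (h : SigmaOne fun x : α × β => p x.1 x.2) :
    ∃ g : α →. β, Partrec g ∧ (∀ a, ∀ b ∈ g a, p a b) ∧ ∀ a, (∃ b, p a b) → (g a).Dom := by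
  obtain ⟨q, hq, hp⟩ := h
  let f : α → ℕ → Option β := fun a k => (Encodable.decode (α := β) k.unpair.1).bind fun b =>
    bif q (a, b) k.unpair.2 then some b else none
  have hf : Primrec₂ f := by
    refine Primrec.option_bind
      (Primrec.decode.comp (Primrec.fst.comp (Primrec.unpair.comp Primrec.snd))) ?_
    refine Primrec.cond ?_ (Primrec.option_some.comp Primrec.snd) (Primrec.const none)
    exact hq.comp (Primrec.pair (Primrec.fst.comp Primrec.fst) Primrec.snd)
      (Primrec.snd.comp (Primrec.unpair.comp (Primrec.snd.comp Primrec.fst)))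
  have hmem : ∀ a k b, b ∈ f a k → p a b := by
    intro a k b hb
    simp only [f, Option.mem_def, Option.bind_eq_some_iff] at hb
    obtain ⟨b', -, hb⟩ := hb
    cases hqb : q (a, b') k.unpair.2
    · simp [hqb] at hb
    · simp only [hqb, cond_true, Option.some.injEq] at hb
      exact hb ▸ (hp (a, b')).2 ⟨_, hqb⟩
  refine ⟨fun a => Nat.rfindOpt (f a), Partrec.rfindOpt hf.to_comp, fun a b hb => ?_,
    fun a ⟨b, hb⟩ => ?_⟩
  · obtain ⟨k, hk⟩ := Nat.rfindOpt_spec hb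
    exact hmem a k b hk
  · obtain ⟨k, hk⟩ := (hp (a, b)).1 hb
    exact Nat.rfindOpt_dom.2 ⟨Nat.pair (Encodable.encode b) k, b, by simp [f, hk]⟩

/-- A total semidecidable relation contains the graph of a computable function. -/
theorem exists_computable {p : α → β → Prop} (h : SigmaOne fun x : α × β => p x.1 x.2)
    (htot : ∀ a, ∃ b, p a b) : ∃ g : α → β, Computable g ∧ ∀ a, p a (g a) := by
  obtain ⟨g, hg, hgp, hdom⟩ := h.exists_partrec
  refine ⟨fun a => (g a).get (hdom a (htot a)), hg.of_eq_tot fun a => Part.get_mem _,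
    fun a => hgp a _ (Part.get_mem _)⟩

/-- Dependent choice for a semidecidable relation that can be continued from good points. -/
theorem exists_sequence {p : ℕ → α → α → Prop} {Good : α → Prop}
    (h : SigmaOne fun x : (ℕ × α) × α => p x.1.1 x.1.2 x.2) {a₀ : α} (h₀ : Good a₀)
    (hex : ∀ n a, Good a → ∃ b, p n a b) (hgood : ∀ n a b, p n a b → Good b) :
    ∃ f : ℕ → α, Computable f ∧ f 0 = a₀ ∧ (∀ n, Good (f n)) ∧ ∀ n, p n (f n) (f (n + 1)) := by
  obtain ⟨g, hg, hgp, hdom⟩ := exists_partrec (p := fun (x : ℕ × α) b => p x.1 x.2 b) h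
  let F : ℕ →. α := fun n =>
    Nat.rec (motive := fun _ => Part α) (Part.some a₀) (fun n ih => ih.bind fun a => g (n, a)) n
  have hF : Partrec F := by
    refine Partrec.nat_rec (f := fun n : ℕ => n) (g := fun _ => Part.some a₀)
      (h := fun (_ : ℕ) (x : ℕ × α) => g x) Computable.id (Computable.const a₀) ?_
    exact hg.comp Computable.snd
  -- `Good` itself is never tested by the algorithm; it only guarantees that each search halts.
  have key : ∀ n, ∃ h : (F n).Dom, Good ((F n).get h) := by
    intro n
    induction n with
    | zero => exact ⟨trivial, h₀⟩
    | succ n ih =>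
      obtain ⟨hn, hgn⟩ := ih
      have hd := hdom (n, (F n).get hn) (hex n _ hgn)
      refine ⟨⟨hn, hd⟩, hgood n _ _ (hgp (n, (F n).get hn) _ (Part.get_mem hd))⟩
  refine ⟨fun n => (F n).get (key n).1, hF.of_eq_tot fun n => Part.get_mem _, rfl,
    fun n => (key n).2, fun n => ?_⟩
  exact hgp (n, (F n).get (key n).1) _
    (Part.get_mem (hdom (n, (F n).get (key n).1) (hex n _ (key n).2)))

end SigmaOne

theorem ComputablePred.sigmaOne {α : Type*} [Primcodable α] {p : α → Prop}
    (h : ComputablePred p) : SigmaOne p := by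
  obtain ⟨_, h⟩ := h
  refine ((SigmaOne.graph h).comp (Primrec.pair Primrec.id (Primrec.const true))).of_eq ?_
  simp

/-! ### Semidecidability and extension of partial lines. -/

namespace SimpleGraph

section Distance

variable {W : Type*} {G : SimpleGraph W} {a b : W}

theorem edist_le_add_one_iff {n : ℕ} :
    G.edist a b ≤ (n + 1 : ℕ) ↔ ∃ c, (a = c ∨ G.Adj a c) ∧ G.edist c b ≤ n := by
  constructor
  · intro h
    have hr : G.Reachable a b :=
      reachable_of_edist_ne_top (ne_top_of_le_ne_top (ENat.natCast_ne_top _) h)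
    obtain ⟨w, hw⟩ := hr.exists_walk_length_eq_edist
    rw [← hw] at h
    cases w with
    | nil => exact ⟨a, .inl rfl, by simp⟩
    | @cons _ c _ hadj w =>
      refine ⟨c, .inr hadj, (edist_le w).trans ?_⟩
      rw [Walk.length_cons, Nat.cast_le] at h
      exact Nat.cast_le.2 (Nat.le_of_succ_le_succ h)
  · rintro ⟨c, hc, h⟩
    have h1 : G.edist a c ≤ 1 := by
      rcases hc with rfl | hc
      · simp
      · exact edist_le_one_of_adj hc
    refine (edist_le_add h1 h).trans ?_
    push_cast
    rw [add_comm]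

/-- This form uses only equality, adjacency and existential quantifiers, so it inherits
semidecidability from adjacency. -/
theorem edist_le_three_iff : G.edist a b ≤ 3 ↔
    ∃ c, (a = c ∨ G.Adj a c) ∧ ∃ d, (c = d ∨ G.Adj c d) ∧ (d = b ∨ G.Adj d b) := by
  have h3 : G.edist a b ≤ 3 ↔ G.edist a b ≤ (2 + 1 : ℕ) := Iff.rfl
  rw [h3]
  simp only [edist_le_add_one_iff]
  simp

end Distance

section Computability

variable {H : SimpleGraph ℕ} {N : Set ℕ} {K : List ℕ} {one : Prop} {dg : ℕ → ℕ}

/-- `(p, q)` are the two halves of a finite 3-path covering `K`, to be continued at `u` and `v`. -/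
structure IsPartialLine (H : SimpleGraph ℕ) (N : Set ℕ) (K : List ℕ) (one : Prop)
    (s : (List ℕ × List ℕ) × (ℕ × ℕ)) : Prop where
  chain_left : (s.1.1 ++ [s.2.1]).IsChain fun a b => H.edist a b ≤ 3
  chain_right : (s.1.2 ++ [s.2.2]).IsChain fun a b => H.edist a b ≤ 3
  link : ∃ a b, (s.1.1.head? = some a ∧ s.1.2.head? = some b) ∧ H.edist a b ≤ 3
  nodup : (s.1.1 ++ s.1.2).Nodup
  subset : ∀ x ∈ s.1.1 ++ s.1.2, x ∈ N
  covered : ∀ k ∈ K, k ∈ s.1.1 ++ s.1.2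
  covers : H.Covers one (N \ {x | x ∈ s.1.1 ++ s.1.2}) s.2.1 s.2.2

/-- A repetition-free list of neighbours whose length is the degree contains all of them. This turns
the quantifier over all boundary vertices into one over finite lists found by search, and leaves
only existential conditions. -/
theorem covers_iff_exists_neighbors (hlf : ∀ v, (H.neighborSet v).Finite)
    (hHN : ∀ a b, H.Adj a b → b ∈ N) (hdg : ∀ a ∈ N, (H.neighborSet a).ncard = dg a)
    (hN : H.ConnectedOn N) {l : List ℕ} (hl : l ≠ []) (hlN : ∀ x ∈ l, x ∈ N) {u v : ℕ} :
    H.Covers one (N \ {x | x ∈ l}) u v ↔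
      (u ∈ N ∧ u ∉ l) ∧ (v ∈ N ∧ v ∉ l) ∧ u ≠ v ∧
      (∀ a ∈ l, ∃ M : List ℕ, (M.Nodup ∧ dg a = M.length) ∧ ∀ y ∈ M, H.Adj a y ∧
        (y ∈ l ∨ H.Joined (N \ {x | x ∈ l}) u y ∨ H.Joined (N \ {x | x ∈ l}) v y)) ∧
      (one → H.Joined (N \ {x | x ∈ l}) u v) := by
  constructor
  · intro h
    refine ⟨h.left_mem, h.right_mem, h.ne, fun a ha => ?_, h.joined_of_one⟩
    refine ⟨(hlf a).toFinset.toList, ⟨Finset.nodup_toList _, ?_⟩, fun y hy => ?_⟩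
    · rw [Finset.length_toList, ← Set.ncard_eq_toFinset_card _ (hlf a), hdg a (hlN a ha)]
    · have hy : H.Adj a y := by simpa using hy
      refine ⟨hy, or_iff_not_imp_left.2 fun hyl => h.joined y ⟨hHN a y hy, hyl⟩⟩
  · rintro ⟨hu, hv, huv, h, hone⟩
    obtain ⟨r, hr⟩ := List.exists_mem_of_ne_nil l hl
    refine hN.covers_of_boundary (fun x hx => hlN x hx) ⟨r, hr⟩ hu hv huv (fun a ha y hy hay => ?_)
      hone
    obtain ⟨M, ⟨hM, hlen⟩, hMa⟩ := h a ha
    have hsub : (M.toFinset : Set ℕ) ⊆ H.neighborSet a := fun z hz => (hMa z (by simpa using hz)).1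
    have heq : (M.toFinset : Set ℕ) = H.neighborSet a := by
      refine Set.eq_of_subset_of_ncard_le hsub ?_ (hlf a)
      rw [hdg a (hlN a ha), hlen, Set.ncard_coe_finset, List.toFinset_card_of_nodup hM]
    have hyM : y ∈ M := by
      have : y ∈ (M.toFinset : Set ℕ) := heq ▸ hay
      simpa using this
    exact (hMa y hyM).2.resolve_left hy.2

theorem sigmaOne_edist_le_three (hadj : SigmaOne fun x : ℕ × ℕ => H.Adj x.1 x.2) :
    SigmaOne fun x : ℕ × ℕ => H.edist x.1 x.2 ≤ 3 := by
  have h1 : SigmaOne fun x : ℕ × ℕ => x.1 = x.2 ∨ H.Adj x.1 x.2 :=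
    (SigmaOne.eq Primrec.fst Primrec.snd).or hadj
  have h2 : SigmaOne fun x : ℕ × ℕ => ∃ c, (x.1 = c ∨ H.Adj x.1 c) ∧
      ∃ d, (c = d ∨ H.Adj c d) ∧ (d = x.2 ∨ H.Adj d x.2) := by
    refine .exists' (.and (h1.comp (Primrec.pair (Primrec.fst.comp Primrec.fst) Primrec.snd))
      (.exists' (.and (h1.comp (Primrec.pair (Primrec.snd.comp Primrec.fst) Primrec.snd))
        (h1.comp (Primrec.pair Primrec.snd (Primrec.snd.comp
          (Primrec.fst.comp Primrec.fst)))))))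
  exact h2.of_eq fun x => edist_le_three_iff.symm

theorem sigmaOne_joined {α : Type*} [Primcodable α] (hN : SigmaOne fun x => x ∈ N)
    (hadj : SigmaOne fun x : ℕ × ℕ => H.Adj x.1 x.2) {l : α → List ℕ} (hl : Primrec l)
    {f g : α → ℕ} (hf : Primrec f) (hg : Primrec g) :
    SigmaOne fun a => H.Joined (N \ {x | x ∈ l a}) (f a) (g a) := by
  refine SigmaOne.reflTransGen (R := fun a x y => H.Adj x y ∧ x ∈ N \ {x | x ∈ l a} ∧
    y ∈ N \ {x | x ∈ l a}) ?_ hf hg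
  have h1 : Primrec fun x : (α × ℕ) × ℕ => x.1.2 := Primrec.snd.comp Primrec.fst
  have hl' : Primrec fun x : (α × ℕ) × ℕ => l x.1.1 := hl.comp (Primrec.fst.comp Primrec.fst)
  exact (hadj.comp (Primrec.pair h1 Primrec.snd)).and
    (((hN.comp h1).and (.notMem_list h1 hl')).and
      ((hN.comp Primrec.snd).and (.notMem_list Primrec.snd hl')))

theorem sigmaOne_isPartialLine (hlf : ∀ v, (H.neighborSet v).Finite)
    (hHN : ∀ a b, H.Adj a b → b ∈ N) (hdg : ∀ a ∈ N, (H.neighborSet a).ncard = dg a)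
    (hdgc : Computable dg) (hN : SigmaOne fun x => x ∈ N)
    (hadj : SigmaOne fun x : ℕ × ℕ => H.Adj x.1 x.2) (hNc : H.ConnectedOn N) :
    SigmaOne (H.IsPartialLine N K one) := by
  have h3 := sigmaOne_edist_le_three hadj
  have hp : Primrec fun s : (List ℕ × List ℕ) × (ℕ × ℕ) => s.1.1 := Primrec.fst.comp Primrec.fst
  have hq : Primrec fun s : (List ℕ × List ℕ) × (ℕ × ℕ) => s.1.2 := Primrec.snd.comp Primrec.fst
  have hu : Primrec fun s : (List ℕ × List ℕ) × (ℕ × ℕ) => s.2.1 := Primrec.fst.comp Primrec.snd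
  have hv : Primrec fun s : (List ℕ × List ℕ) × (ℕ × ℕ) => s.2.2 := Primrec.snd.comp Primrec.snd
  have hl : Primrec fun s : (List ℕ × List ℕ) × (ℕ × ℕ) => s.1.1 ++ s.1.2 :=
    Primrec.list_append.comp hp hq
  have hchain : ∀ {l : (List ℕ × List ℕ) × (ℕ × ℕ) → List ℕ}, Primrec l →
      SigmaOne fun s => (l s).IsChain fun a b => H.edist a b ≤ 3 := fun hl =>
    SigmaOne.isChain (R := fun _ a b => H.edist a b ≤ 3)
      (h3.comp (Primrec.pair (Primrec.snd.comp Primrec.fst) Primrec.snd)) hl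
  have hlink : SigmaOne fun s : (List ℕ × List ℕ) × (ℕ × ℕ) =>
      ∃ a b, (s.1.1.head? = some a ∧ s.1.2.head? = some b) ∧ H.edist a b ≤ 3 := by
    refine .exists' (.exists' (.and (.and (.eq ?_ ?_) (.eq ?_ ?_)) (h3.comp (Primrec.pair ?_ ?_))))
    · exact Primrec.list_head?.comp (hp.comp (Primrec.fst.comp Primrec.fst))
    · exact Primrec.option_some.comp (Primrec.snd.comp Primrec.fst)
    · exact Primrec.list_head?.comp (hq.comp (Primrec.fst.comp Primrec.fst))
    · exact Primrec.option_some.comp Primrec.snd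
    · exact Primrec.snd.comp Primrec.fst
    · exact Primrec.snd
  have hbd : SigmaOne fun s : (List ℕ × List ℕ) × (ℕ × ℕ) =>
      ∀ a ∈ s.1.1 ++ s.1.2, ∃ M : List ℕ, (M.Nodup ∧ dg a = M.length) ∧ ∀ y ∈ M, H.Adj a y ∧
        (y ∈ s.1.1 ++ s.1.2 ∨ H.Joined (N \ {x | x ∈ s.1.1 ++ s.1.2}) s.2.1 y ∨
          H.Joined (N \ {x | x ∈ s.1.1 ++ s.1.2}) s.2.2 y) := by
    refine .forall_mem (p := fun s a => ∃ M : List ℕ, (M.Nodup ∧ dg a = M.length) ∧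
      ∀ y ∈ M, H.Adj a y ∧ (y ∈ s.1.1 ++ s.1.2 ∨
        H.Joined (N \ {x | x ∈ s.1.1 ++ s.1.2}) s.2.1 y ∨
          H.Joined (N \ {x | x ∈ s.1.1 ++ s.1.2}) s.2.2 y)) (.exists' (.and (.and ?_ ?_) ?_)) hl
    · exact .nodup Primrec.snd
    · exact (SigmaOne.graph hdgc).comp
        (Primrec.pair (Primrec.snd.comp Primrec.fst) (Primrec.list_length.comp Primrec.snd))
    · refine .forall_mem (p := fun (z : (((List ℕ × List ℕ) × (ℕ × ℕ)) × ℕ) × List ℕ) y =>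
        H.Adj z.1.2 y ∧ (y ∈ z.1.1.1.1 ++ z.1.1.1.2 ∨
          H.Joined (N \ {x | x ∈ z.1.1.1.1 ++ z.1.1.1.2}) z.1.1.2.1 y ∨
            H.Joined (N \ {x | x ∈ z.1.1.1.1 ++ z.1.1.1.2}) z.1.1.2.2 y))
        (.and (hadj.comp (Primrec.pair ?_ Primrec.snd)) (.or (.mem_list Primrec.snd ?_)
          (.or (sigmaOne_joined hN hadj ?_ ?_ Primrec.snd)
            (sigmaOne_joined hN hadj ?_ ?_ Primrec.snd)))) Primrec.snd
      · exact Primrec.snd.comp (Primrec.fst.comp Primrec.fst)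
      · exact hl.comp (Primrec.fst.comp (Primrec.fst.comp Primrec.fst))
      · exact hl.comp (Primrec.fst.comp (Primrec.fst.comp Primrec.fst))
      · exact hu.comp (Primrec.fst.comp (Primrec.fst.comp Primrec.fst))
      · exact hl.comp (Primrec.fst.comp (Primrec.fst.comp Primrec.fst))
      · exact hv.comp (Primrec.fst.comp (Primrec.fst.comp Primrec.fst))
  have hsub : SigmaOne fun s : (List ℕ × List ℕ) × (ℕ × ℕ) => ∀ x ∈ s.1.1 ++ s.1.2, x ∈ N :=
    .forall_mem (p := fun _ x => x ∈ N) (hN.comp Primrec.snd) hl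
  have hcov : SigmaOne fun s : (List ℕ × List ℕ) × (ℕ × ℕ) => ∀ k ∈ K, k ∈ s.1.1 ++ s.1.2 :=
    .forall_mem (p := fun (s : (List ℕ × List ℕ) × (ℕ × ℕ)) k => k ∈ s.1.1 ++ s.1.2)
      (.mem_list Primrec.snd (hl.comp Primrec.fst)) (Primrec.const K)
  have hall := ((hchain (Primrec.list_concat.comp hp hu)).and
    ((hchain (Primrec.list_concat.comp hq hv)).and (hlink.and ((SigmaOne.nodup hl).and
      (hsub.and (hcov.and (((hN.comp hu).and (.notMem_list hu hl)).and
        (((hN.comp hv).and (.notMem_list hv hl)).and ((SigmaOne.ne hu hv).and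
          (hbd.and (.imp_const (P := one) (sigmaOne_joined hN hadj hl hu hv))))))))))))
  refine hall.of_eq fun s => ?_
  have hne : (∃ a b, (s.1.1.head? = some a ∧ s.1.2.head? = some b) ∧ H.edist a b ≤ 3) →
      s.1.1 ++ s.1.2 ≠ [] := by
    rintro ⟨a, b, ⟨h, -⟩, -⟩ h'
    simp [(List.append_eq_nil_iff.1 h').1] at h
  constructor
  · rintro ⟨h1, h2, h3, h4, h5, h6, h7⟩
    exact ⟨h1, h2, h3, h4, h5, h6,
      (covers_iff_exists_neighbors hlf hHN hdg hNc (hne h3) h5).2 h7⟩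
  · rintro ⟨h1, h2, h3, h4, h5, h6, h7⟩
    exact ⟨h1, h2, h3, h4, h5, h6,
      (covers_iff_exists_neighbors hlf hHN hdg hNc (hne h3) h5).1 h7⟩

/-- `s'` extends `s` at both ends and covers `n`, if `n` is a vertex. -/
def LineStep (H : SimpleGraph ℕ) (N : Set ℕ) (K : List ℕ) (one : Prop) (n : ℕ)
    (s s' : (List ℕ × List ℕ) × (ℕ × ℕ)) : Prop :=
  H.IsPartialLine N K one s' ∧ (∃ t, s'.1.1 = s.1.1 ++ t ∧ t ≠ []) ∧
    (∃ t, s'.1.2 = s.1.2 ++ t ∧ t ≠ []) ∧ (n ∉ N ∨ n ∈ s'.1.1 ++ s'.1.2)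

theorem sigmaOne_lineStep (h : SigmaOne (H.IsPartialLine N K one))
    (hN : SigmaOne fun x => x ∉ N) :
    SigmaOne fun x : (ℕ × ((List ℕ × List ℕ) × (ℕ × ℕ))) × ((List ℕ × List ℕ) × (ℕ × ℕ)) =>
      H.LineStep N K one x.1.1 x.1.2 x.2 := by
  have hp : Primrec fun s : (List ℕ × List ℕ) × (ℕ × ℕ) => s.1.1 := Primrec.fst.comp Primrec.fst
  have hq : Primrec fun s : (List ℕ × List ℕ) × (ℕ × ℕ) => s.1.2 := Primrec.snd.comp Primrec.fst
  have hs : Primrec fun x : ((ℕ × ((List ℕ × List ℕ) × (ℕ × ℕ))) ×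
      ((List ℕ × List ℕ) × (ℕ × ℕ))) × List ℕ => x.1.1.2 :=
    Primrec.snd.comp (Primrec.fst.comp Primrec.fst)
  have hs' : Primrec fun x : ((ℕ × ((List ℕ × List ℕ) × (ℕ × ℕ))) ×
      ((List ℕ × List ℕ) × (ℕ × ℕ))) × List ℕ => x.1.2 := Primrec.snd.comp Primrec.fst
  refine .and (h.comp Primrec.snd) (.and (.exists' (.and (.eq ?_ ?_) ?_))
    (.and (.exists' (.and (.eq ?_ ?_) ?_)) (.or ?_ (.mem_list ?_ ?_))))
  · exact hp.comp hs'
  · exact Primrec.list_append.comp (hp.comp hs) Primrec.snd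
  · exact .ne Primrec.snd (Primrec.const [])
  · exact hq.comp hs'
  · exact Primrec.list_append.comp (hq.comp hs) Primrec.snd
  · exact .ne Primrec.snd (Primrec.const [])
  · exact hN.comp (Primrec.fst.comp Primrec.fst)
  · exact Primrec.fst.comp Primrec.fst
  · exact Primrec.list_append.comp (hp.comp Primrec.snd) (hq.comp Primrec.snd)

theorem Ham.exists_list_append {S : Set ℕ} {u a u' : ℕ} (h : H.Ham S u a)
    (hau : H.edist a u' ≤ 3) : ∃ t : List ℕ, (u :: t).Nodup ∧ (∀ x, x ∈ u :: t ↔ x ∈ S) ∧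
      (u :: (t ++ [u'])).IsChain fun a b => H.edist a b ≤ 3 := by
  obtain ⟨l, hhead, hlast, hnd, hmem, hch⟩ := h.exists_list
  obtain ⟨t, rfl⟩ := List.head?_eq_some_iff.1 hhead
  refine ⟨t, hnd, hmem, ?_⟩
  rw [← List.cons_append]
  refine List.isChain_append.2 ⟨hch, List.isChain_singleton _, ?_⟩
  rw [hlast]
  rintro x hx y hy
  simp only [Option.mem_def, Option.some.injEq, List.head?_cons] at hx hy
  subst hx hy
  exact hau

theorem exists_isPartialLine (hlf : ∀ v, (H.neighborSet v).Finite)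
    (h : H.EndsAs one N {x | x ∈ K}) (hKN : ∀ x ∈ K, x ∈ N) :
    ∃ s, H.IsPartialLine N K one s := by
  obtain ⟨T₁, T₂, a₀, b₀, a, b, u, v, hKT, hTN, hd, hab, h₁, h₂, hau, hbv, hc⟩ :=
    h.exists_initial hlf (List.finite_toSet K) hKN
  obtain ⟨p, hp, hpT, hpc⟩ := h₁.exists_list_append hau
  obtain ⟨q, hq, hqT, hqc⟩ := h₂.exists_list_append hbv
  have hmem : ∀ x, x ∈ (a₀ :: p) ++ (b₀ :: q) ↔ x ∈ T₁ ∪ T₂ := fun x => by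
    rw [List.mem_append, hpT, hqT]; rfl
  refine ⟨((a₀ :: p, b₀ :: q), (u, v)), hpc, hqc, ⟨a₀, b₀, ⟨rfl, rfl⟩, hab⟩, ?_,
    fun x hx => hTN ((hmem x).1 hx), fun k hk => (hmem k).2 (hKT hk), ?_⟩
  · exact hp.append hq fun x hx hx' =>
      Set.disjoint_left.1 hd ((hpT x).1 hx) ((hqT x).1 hx')
  · rw [show {x | x ∈ (a₀ :: p) ++ (b₀ :: q)} = T₁ ∪ T₂ from Set.ext hmem]
    exact hc

theorem IsPartialLine.exists_lineStep (hlf : ∀ v, (H.neighborSet v).Finite)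
    (h : H.EndsAs one N {x | x ∈ K}) {s : (List ℕ × List ℕ) × (ℕ × ℕ)}
    (hs : H.IsPartialLine N K one s) (n : ℕ) : ∃ s', H.LineStep N K one n s s' := by
  obtain ⟨⟨p, q⟩, u, v⟩ := s
  obtain ⟨hp, hq, ⟨a₀, b₀, ⟨ha₀, hb₀⟩, hab⟩, hnd, hsub, hK, hc⟩ := hs
  dsimp only at *
  obtain ⟨T₁, T₂, a, b, u', v', hFT, hTN, hd, h₁, h₂, hau, hbv, hc'⟩ :=
    h.exists_extension hlf (L := {x | x ∈ p ++ q}) (List.finite_toSet _) hK hc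
      (F := {n} ∩ (N \ {x | x ∈ p ++ q})) ((Set.finite_singleton n).inter_of_left _)
      Set.inter_subset_right
  obtain ⟨t, ht, htT, htc⟩ := h₁.exists_list_append hau
  obtain ⟨r, hr, hrT, hrc⟩ := h₂.exists_list_append hbv
  have hmem : ∀ x, x ∈ (p ++ u :: t) ++ (q ++ v :: r) ↔ x ∈ p ++ q ∨ x ∈ T₁ ∪ T₂ := fun x => by
    have h1 := htT x
    have h2 := hrT x
    simp only [List.mem_append, Set.mem_union, ← h1, ← h2]
    tauto
  have hfresh : ∀ x ∈ T₁ ∪ T₂, x ∉ p ++ q := fun x hx => (hTN hx).2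
  refine ⟨((p ++ u :: t, q ++ v :: r), (u', v')), ⟨?_, ?_, ?_, ?_, fun x hx => ?_, fun k hk => ?_,
    ?_⟩, ⟨u :: t, rfl, by simp⟩, ⟨v :: r, rfl, by simp⟩, ?_⟩
  -- The old chain ends with its entrance `u` and the new one starts with it, so they are glued
  -- along `u`.
  · have := hp.append_overlap htc (by simp)
    simpa using this
  · have := hq.append_overlap hrc (by simp)
    simpa using this
  · exact ⟨a₀, b₀, by simp [List.head?_append, ha₀, hb₀], hab⟩
  · have hnd' := List.nodup_append.1 hnd
    refine List.Nodup.append (List.Nodup.append hnd'.1 ht ?_) (List.Nodup.append hnd'.2.1 hr ?_) ?_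
    · exact fun x hx hx' => hfresh x (.inl ((htT x).1 hx')) (List.mem_append_left _ hx)
    · exact fun x hx hx' => hfresh x (.inr ((hrT x).1 hx')) (List.mem_append_right _ hx)
    · intro x hx hx'
      rcases List.mem_append.1 hx with hx | hx <;> rcases List.mem_append.1 hx' with hx' | hx'
      · exact hnd'.2.2 x hx x hx' rfl
      · exact hfresh x (.inr ((hrT x).1 hx')) (List.mem_append_left _ hx)
      · exact hfresh x (.inl ((htT x).1 hx)) (List.mem_append_right _ hx')
      · exact Set.disjoint_left.1 hd ((htT x).1 hx) ((hrT x).1 hx')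
  · exact ((hmem x).1 hx).elim (hsub x) fun h => (hTN h).1
  · exact (hmem k).2 (.inl (hK k hk))
  · have : N \ {x | x ∈ (p ++ u :: t) ++ (q ++ v :: r)} =
        (N \ {x | x ∈ p ++ q}) \ (T₁ ∪ T₂) := by
      rw [Set.sdiff_sdiff]
      exact congrArg (N \ ·) (Set.ext hmem)
    dsimp only
    rw [this]
    exact hc'
  · rw [or_iff_not_imp_left, not_not]
    intro hn
    refine (hmem n).2 (or_iff_not_imp_left.2 fun hn' => hFT ⟨rfl, hn, hn'⟩)

end Computability

end SimpleGraph

/-! ### Limits of growing lists. -/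

section Limit

/-- The common limit of a computable, strictly increasing sequence of lists. -/
theorem exists_computable_limit {l : ℕ → List ℕ} (hl : Computable l) (h₀ : l 0 ≠ [])
    (hstep : ∀ n, ∃ t, l (n + 1) = l n ++ t ∧ t ≠ []) :
    ∃ e : ℕ → ℕ, Computable e ∧ (∀ n, n < (l n).length) ∧
      ∀ m i, i < (l m).length → (l m)[i]? = some (e i) := by
  have hlen : ∀ n, n < (l n).length := by
    intro n
    induction n with
    | zero => exact List.length_pos_of_ne_nil h₀
    | succ n ih =>
      obtain ⟨t, ht, hne⟩ := hstep n
      have := List.length_pos_of_ne_nil hne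
      rw [ht, List.length_append]
      omega
  have hpre : ∀ m k, l m <+: l (m + k) := by
    intro m k
    induction k with
    | zero => exact List.prefix_rfl
    | succ k ih =>
      obtain ⟨t, ht, -⟩ := hstep (m + k)
      exact ih.trans ⟨t, ht.symm⟩
  -- The list at stage `i` has more than `i` entries, so the default 0 is never used.
  refine ⟨fun i => ((l i)[i]?).getD 0, ?_, hlen, fun m i hi => ?_⟩
  · exact Computable.option_getD (Computable.list_getElem?.comp hl Computable.id)
      (Computable.const 0)
  · have key : (l m)[i]? = (l i)[i]? := by
      rcases le_total m i with h | h
      · obtain ⟨k, rfl⟩ := Nat.exists_eq_add_of_le h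
        obtain ⟨t, ht⟩ := hpre m k
        rw [← ht, List.getElem?_append_left hi]
      · obtain ⟨k, rfl⟩ := Nat.exists_eq_add_of_le h
        obtain ⟨t, ht⟩ := hpre i k
        rw [← ht, List.getElem?_append_left (hlen i)]
    rw [key]
    simp [List.getElem?_eq_getElem (hlen i)]

end Limit

/-! ### Integer codes and translation. -/

section IntCodes

theorem intEquivNat_symm_two_mul (n : ℕ) : Equiv.intEquivNat.symm (2 * n) = (n : ℤ) := by
  rw [Equiv.symm_apply_eq]; rfl

theorem intEquivNat_symm_two_mul_add_one (n : ℕ) :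
    Equiv.intEquivNat.symm (2 * n + 1) = Int.negSucc n := by
  rw [Equiv.symm_apply_eq]; rfl

theorem intEquivNat_symm_eq (n : ℕ) :
    Equiv.intEquivNat.symm n = bif n.bodd then Int.negSucc n.div2 else (n.div2 : ℤ) := by
  cases h : n.bodd
  · rw [cond_false, ← intEquivNat_symm_two_mul]
    congr 1
    have := Nat.bodd_add_div2 n
    simp only [h, Bool.toNat_false] at this
    omega
  · rw [cond_true, ← intEquivNat_symm_two_mul_add_one]
    congr 1
    have := Nat.bodd_add_div2 n
    simp only [h, Bool.toNat_true] at this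
    omega

/-- Addition is computable in the standard numbering of the integers. -/
theorem exists_primrec_int_add : ∃ f : ℕ × ℕ → ℕ, Primrec f ∧ ∀ x, Equiv.intEquivNat.symm (f x) =
    Equiv.intEquivNat.symm x.1 + Equiv.intEquivNat.symm x.2 := by
  -- Writing integers as differences of naturals reduces addition to one comparison. A negative `-k`
  -- has code `2 * (k - 1) + 1`, which accounts for the extra subtraction below.
  let pos : ℕ → ℕ := fun n => bif n.bodd then 0 else n.div2
  let neg : ℕ → ℕ := fun n => bif n.bodd then n.div2 + 1 else 0
  have hpos : Primrec pos := Primrec.cond Primrec.nat_bodd (Primrec.const 0) Primrec.nat_div2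
  have hneg : Primrec neg :=
    Primrec.cond Primrec.nat_bodd (Primrec.succ.comp Primrec.nat_div2) (Primrec.const 0)
  have hval : ∀ n, Equiv.intEquivNat.symm n = (pos n : ℤ) - neg n := by
    intro n
    rw [intEquivNat_symm_eq]
    cases h : n.bodd
    · simp [pos, neg, h]
    · simp [pos, neg, h, Int.negSucc_eq]
  have hP : Primrec fun x : ℕ × ℕ => pos x.1 + pos x.2 :=
    Primrec.nat_add.comp (hpos.comp Primrec.fst) (hpos.comp Primrec.snd)
  have hM : Primrec fun x : ℕ × ℕ => neg x.1 + neg x.2 :=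
    Primrec.nat_add.comp (hneg.comp Primrec.fst) (hneg.comp Primrec.snd)
  refine ⟨fun x => if neg x.1 + neg x.2 ≤ pos x.1 + pos x.2
    then 2 * (pos x.1 + pos x.2 - (neg x.1 + neg x.2))
    else 2 * (neg x.1 + neg x.2 - (pos x.1 + pos x.2) - 1) + 1, ?_, fun x => ?_⟩
  · refine Primrec.ite (Primrec.nat_le.comp hM hP) ?_ ?_
    · exact Primrec.nat_mul.comp (Primrec.const 2) (Primrec.nat_sub.comp hP hM)
    · exact Primrec.succ.comp (Primrec.nat_mul.comp (Primrec.const 2)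
        (Primrec.nat_sub.comp (Primrec.nat_sub.comp hM hP) (Primrec.const 1)))
  · dsimp only
    rw [hval x.1, hval x.2]
    split_ifs with h
    · rw [intEquivNat_symm_two_mul]
      omega
    · rw [intEquivNat_symm_two_mul_add_one, Int.negSucc_eq]
      omega

/-- Translation along a computable injection of `ℤ` into `ℕ` with decidable range is computable. -/
theorem exists_computable_int_translation {e : ℤ → ℕ} {N : Set ℕ}
    (hec : Computable fun n => e (Equiv.intEquivNat.symm n)) (hinj : Function.Injective e)
    (hrange : Set.range e = N) (hN : ComputablePred fun n => n ∈ N) :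
    ∃ F : ℕ → ℕ, Computable F ∧
      ∀ y z, F (Nat.pair (e y) (Equiv.intEquivNat z)) = e (y + z) := by
  obtain ⟨add, hadd, hadd'⟩ := exists_primrec_int_add
  -- The second alternative inverts `e` by search; the first lets the search halt on numbers outside
  -- `N`, so that the resulting function is total.
  have hrel : SigmaOne fun x : ℕ × ℕ => x.1.unpair.1 ∉ N ∨
      ∃ c : ℕ, e (Equiv.intEquivNat.symm c) = x.1.unpair.1 ∧
        e (Equiv.intEquivNat.symm (add (c, x.1.unpair.2))) = x.2 := by
    have h1 := SigmaOne.graph hec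
    have hu : Primrec fun x : ℕ × ℕ => x.1.unpair := Primrec.unpair.comp Primrec.fst
    refine .or (hN.not.sigmaOne.comp (Primrec.fst.comp hu))
      (.exists' (.and (h1.comp (Primrec.pair Primrec.snd ?_)) (h1.comp (Primrec.pair ?_ ?_))))
    · exact Primrec.fst.comp (hu.comp Primrec.fst)
    · exact hadd.comp (Primrec.pair Primrec.snd (Primrec.snd.comp (hu.comp Primrec.fst)))
    · exact Primrec.snd.comp Primrec.fst
  obtain ⟨F, hF, hFrel⟩ := SigmaOne.exists_computable (p := fun (m y : ℕ) => m.unpair.1 ∉ N ∨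
      ∃ c : ℕ, e (Equiv.intEquivNat.symm c) = m.unpair.1 ∧
        e (Equiv.intEquivNat.symm (add (c, m.unpair.2))) = y) hrel (by
    intro m
    by_cases hm : m.unpair.1 ∈ N
    · obtain ⟨y, hy⟩ : m.unpair.1 ∈ Set.range e := hrange ▸ hm
      exact ⟨_, .inr ⟨Equiv.intEquivNat y, by rw [Equiv.symm_apply_apply, hy], rfl⟩⟩
    · exact ⟨0, .inl hm⟩)
  refine ⟨F, hF, fun y z => ?_⟩
  have h := hFrel (Nat.pair (e y) (Equiv.intEquivNat z))
  rw [Nat.unpair_pair] at h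
  obtain ⟨c, hc, hFc⟩ := h.resolve_left (not_not.2 (hrange ▸ Set.mem_range_self y))
  rw [← hFc, hadd', hinj hc, Equiv.symm_apply_apply]

end IntCodes

/-! ### Assembling the computable line. -/

namespace SimpleGraph

/-- A one-ended or two-ended computable graph on a set of natural numbers has a computable
bi-infinite Hamiltonian 3-path. -/
theorem exists_computable_line {H : SimpleGraph ℕ} {N : Set ℕ} {K : List ℕ} {one : Prop}
    {dg : ℕ → ℕ} (hlf : ∀ v, (H.neighborSet v).Finite) (hHN : ∀ a b, H.Adj a b → b ∈ N)
    (hdg : ∀ a ∈ N, (H.neighborSet a).ncard = dg a) (hdgc : Computable dg)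
    (hN : ComputablePred fun x => x ∈ N)
    (hadj : SigmaOne fun x : ℕ × ℕ => H.Adj x.1 x.2) (h : H.EndsAs one N {x | x ∈ K})
    (hKN : ∀ x ∈ K, x ∈ N) :
    ∃ e : ℤ → ℕ, Computable (fun n => e (Equiv.intEquivNat.symm n)) ∧ Function.Injective e ∧
      Set.range e = N ∧ ∀ z, H.edist (e z) (e (z + 1)) ≤ 3 := by
  have hline : SigmaOne (H.IsPartialLine N K one) :=
    sigmaOne_isPartialLine hlf hHN hdg hdgc hN.sigmaOne hadj h.connectedOn
  obtain ⟨s₀, hs₀⟩ := exists_isPartialLine hlf h hKN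
  obtain ⟨f, hf, -, hgood, hstep⟩ := (sigmaOne_lineStep hline hN.not.sigmaOne).exists_sequence hs₀
    (fun n s hs => hs.exists_lineStep hlf h n) fun n s s' hs => hs.1
  have hhead := (hgood 0).link
  obtain ⟨eP, hePc, hlenP, heP⟩ := exists_computable_limit (l := fun n => (f n).1.1)
    (Computable.fst.comp (Computable.fst.comp hf))
    (by obtain ⟨a, b, ⟨ha, -⟩, -⟩ := hhead; intro h'; simp [h'] at ha)
    fun n => (hstep n).2.1
  obtain ⟨eQ, heQc, hlenQ, heQ⟩ := exists_computable_limit (l := fun n => (f n).1.2)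
    (Computable.snd.comp (Computable.fst.comp hf))
    (by obtain ⟨a, b, ⟨-, hb⟩, -⟩ := hhead; intro h'; simp [h'] at hb)
    fun n => (hstep n).2.2.1
  have hP : ∀ {m i}, i ≤ m → (f m).1.1[i]? = some (eP i) := fun {m i} him =>
    heP m i (him.trans_lt (hlenP m))
  have hQ : ∀ {m i}, i ≤ m → (f m).1.2[i]? = some (eQ i) := fun {m i} him =>
    heQ m i (him.trans_lt (hlenQ m))
  have hnd := fun m => List.nodup_append.1 (hgood m).nodup
  have hstepP : ∀ i, H.edist (eP i) (eP (i + 1)) ≤ 3 := by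
    intro i
    have hch := List.isChain_iff_getElem.1 (hgood (i + 1)).chain_left.left_of_append i
      (hlenP (i + 1))
    obtain ⟨_, h1⟩ := List.getElem?_eq_some_iff.1 (hP (Nat.le_succ i))
    obtain ⟨_, h2⟩ := List.getElem?_eq_some_iff.1 (hP (le_refl (i + 1)))
    rwa [h1, h2] at hch
  have hstepQ : ∀ i, H.edist (eQ i) (eQ (i + 1)) ≤ 3 := by
    intro i
    have hch := List.isChain_iff_getElem.1 (hgood (i + 1)).chain_right.left_of_append i
      (hlenQ (i + 1))
    obtain ⟨_, h1⟩ := List.getElem?_eq_some_iff.1 (hQ (Nat.le_succ i))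
    obtain ⟨_, h2⟩ := List.getElem?_eq_some_iff.1 (hQ (le_refl (i + 1)))
    rwa [h1, h2] at hch
  have hlink : H.edist (eP 0) (eQ 0) ≤ 3 := by
    obtain ⟨a, b, ⟨ha, hb⟩, hab⟩ := hhead
    rw [List.head?_eq_getElem?, hP le_rfl, Option.some.injEq] at ha
    rw [List.head?_eq_getElem?, hQ le_rfl, Option.some.injEq] at hb
    rwa [ha, hb]
  have hinj : ∀ {l : List ℕ} {i j a : ℕ}, l.Nodup → l[i]? = some a → l[j]? = some a → i = j := by
    intro l i j a hl hi hj
    obtain ⟨hi', hi⟩ := List.getElem?_eq_some_iff.1 hi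
    obtain ⟨hj', hj⟩ := List.getElem?_eq_some_iff.1 hj
    exact (hl.getElem_inj_iff).1 (hi.trans hj.symm)
  have hPQ : ∀ i j, eP i ≠ eQ j := fun i j =>
    (hnd (max i j)).2.2 _ (List.mem_of_getElem? (hP (le_max_left i j))) _
      (List.mem_of_getElem? (hQ (le_max_right i j)))
  -- The right half occupies 0, 1, 2, … and the left half -1, -2, …, so the link between the two
  -- heads is the step from -1 to 0.
  refine ⟨fun z => Int.casesOn z eQ eP, ?_, ?_, Set.Subset.antisymm ?_ ?_, ?_⟩
  · refine (Computable.cond Computable.nat_bodd (hePc.comp Computable.nat_div2)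
      (heQc.comp Computable.nat_div2)).of_eq fun n => ?_
    rw [intEquivNat_symm_eq]
    cases n.bodd <;> rfl
  · rintro (i | i) (j | j) hij
    · have hij : eQ i = eQ j := hij
      rw [hinj (hnd (max i j)).2.1 (hQ (le_max_left i j)) (hij ▸ hQ (le_max_right i j))]
    · exact (hPQ j i hij.symm).elim
    · exact (hPQ i j hij).elim
    · have hij : eP i = eP j := hij
      rw [hinj (hnd (max i j)).1 (hP (le_max_left i j)) (hij ▸ hP (le_max_right i j))]
  · rintro _ ⟨i | i, rfl⟩
    · exact (hgood i).subset _ (List.mem_append_right _ (List.mem_of_getElem? (hQ le_rfl)))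
    · exact (hgood i).subset _ (List.mem_append_left _ (List.mem_of_getElem? (hP le_rfl)))
  -- The step from stage `x` to stage `x + 1` puts `x` on the path.
  · intro x hx
    rcases List.mem_append.1 ((hstep x).2.2.2.resolve_left (not_not.2 hx)) with hx | hx
    · obtain ⟨i, hi, hix⟩ := List.mem_iff_getElem.1 hx
      have := heP (x + 1) i hi
      rw [List.getElem?_eq_getElem hi, hix, Option.some.injEq] at this
      exact ⟨Int.negSucc i, this.symm⟩
    · obtain ⟨i, hi, hix⟩ := List.mem_iff_getElem.1 hx
      have := heQ (x + 1) i hi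
      rw [List.getElem?_eq_getElem hi, hix, Option.some.injEq] at this
      exact ⟨Int.ofNat i, this.symm⟩
  · rintro (i | _ | i)
    · exact hstepQ i
    · exact hlink
    · exact edist_le_symm (hstepP i)

/-! ### Transport along an embedding into the natural numbers -/

section Transport

variable {V W : Type*} {G : SimpleGraph V} {φ : V ↪ W} {K : Set W} {v w : V}

theorem Joined.exists_of_map {y : W}
    (h : (G.map φ).Joined (Set.range φ \ K) (φ v) y) : ∃ w, φ w = y ∧ G.Joined (φ ⁻¹' K)ᶜ v w := by
  induction h with
  | refl => exact ⟨v, rfl, .refl v⟩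
  | tail _ h ih =>
    obtain ⟨w, rfl, hw⟩ := ih
    obtain ⟨hadj, hb, ⟨t, rfl⟩, hc⟩ := h
    exact ⟨t, rfl, hw.trans (.of_adj (map_adj_apply.1 hadj) hb.2 hc)⟩

theorem joined_map_iff :
    (G.map φ).Joined (Set.range φ \ K) (φ v) (φ w) ↔ G.Joined (φ ⁻¹' K)ᶜ v w := by
  constructor
  · intro h
    obtain ⟨w', hw', h⟩ := h.exists_of_map
    rwa [φ.injective hw'] at h
  · exact Relation.ReflTransGen.lift (p := fun a b => (G.map φ).Adj a b ∧
      a ∈ Set.range φ \ K ∧ b ∈ Set.range φ \ K) φ (fun a b h =>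
      ⟨map_adj_apply.2 h.1, ⟨⟨a, rfl⟩, h.2.1⟩, ⟨⟨b, rfl⟩, h.2.2⟩⟩) v w

theorem componentIn_map :
    (G.map φ).componentIn (Set.range φ \ K) (φ v) = φ '' G.componentIn (φ ⁻¹' K)ᶜ v := by
  ext y
  constructor
  · intro h
    obtain ⟨w, hw, h⟩ := Joined.exists_of_map h
    exact ⟨w, h, hw⟩
  · rintro ⟨w, h, rfl⟩
    exact joined_map_iff.2 h

/-- Links the walk-based components used above to the components in the definition of `numEnds`. -/
theorem joined_compl_iff {K : Set V} (hv : v ∉ K) (hw : w ∉ K) :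
    G.Joined Kᶜ v w ↔ G.componentComplMk hv = G.componentComplMk hw := by
  constructor
  · intro h
    have key : ∃ hw : w ∉ K, G.componentComplMk hv = G.componentComplMk hw := by
      clear hw
      induction h with
      | refl => exact ⟨hv, rfl⟩
      | tail _ h ih =>
        obtain ⟨hb, ih⟩ := ih
        exact ⟨h.2.2, ih.trans (componentComplMk_eq_of_adj G hb h.2.2 h.1)⟩
    exact key.2
  · intro h
    have h := (reachable_iff_reflTransGen _ _).1 (ConnectedComponent.exact h)
    exact Relation.ReflTransGen.lift (p := fun a b => G.Adj a b ∧ a ∈ Kᶜ ∧ b ∈ Kᶜ)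
      Subtype.val (fun a b h => ⟨h, a.2, b.2⟩) _ _ h

theorem componentIn_compl {K : Set V} (hv : v ∉ K) :
    G.componentIn Kᶜ v = (G.componentComplMk hv).supp := by
  ext w
  constructor
  · intro h
    have hw : w ∉ K := Joined.mem h hv
    exact ⟨hw, ((joined_compl_iff hv hw).1 h).symm⟩
  · rintro ⟨hw, h⟩
    exact (joined_compl_iff hv hw).2 h.symm

theorem connectedOn_range_map (h : G.Connected) : (G.map φ).ConnectedOn (Set.range φ) := by
  rintro _ ⟨v, rfl⟩ _ ⟨w, rfl⟩
  refine Relation.ReflTransGen.lift (p := fun a b => (G.map φ).Adj a b ∧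
    a ∈ Set.range φ ∧ b ∈ Set.range φ) φ
    (fun a b h => ⟨map_adj_apply.2 h, ⟨a, rfl⟩, ⟨b, rfl⟩⟩) v w ?_
  exact (reachable_iff_reflTransGen _ _).1 (h v w)

theorem infinite_of_numEnds_ne_zero (h : G.numEnds ≠ 0) : Infinite V := by
  by_contra hV
  rw [not_infinite_iff_finite] at hV
  refine h (ENat.iSup_eq_zero.2 fun K => ?_)
  rw [Set.encard_eq_zero, Set.eq_empty_iff_forall_notMem]
  exact fun C hC => hC (Set.toFinite _)

theorem infinite_supp_of_map {x : V} {K : Set W} (hx : φ x ∉ K)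
    (h : ((G.map φ).componentIn (Set.range φ \ K) (φ x)).Infinite) :
    (G.componentComplMk (K := φ ⁻¹' K) hx).supp.Infinite := by
  rw [← componentIn_compl]
  rw [componentIn_map] at h
  exact h.of_image φ

/-- With one end no separator is needed and `K` is empty. With two, the supremum exceeds 1, so some
finite `K` leaves two infinite components, while three pairwise different ones would exceed it. -/
theorem endsAs_of_numEnds [Infinite V] (hconn : G.Connected)
    (hends : G.numEnds = 1 ∨ G.numEnds = 2) :
    ∃ (one : Prop) (K : List W), (∀ x ∈ K, x ∈ Set.range φ) ∧
      (G.map φ).EndsAs one (Set.range φ) {x | x ∈ K} := by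
  have hinf : (Set.range φ).Infinite := Set.infinite_range_of_injective φ.injective
  have hle : ∀ K : Set V, K.Finite →
      {C : G.ComponentCompl K | C.supp.Infinite}.encard ≤ G.numEnds := by
    intro K hK
    obtain ⟨K, rfl⟩ := hK.exists_finset_coe
    exact le_iSup (fun K : Finset V => {C : G.ComponentCompl (K : Set V) |
      C.supp.Infinite}.encard) K
  rcases hends with hends | hends
  · refine ⟨True, [], by simp, .inl ⟨trivial, hinf, connectedOn_range_map hconn, ?_⟩⟩
    rintro K hK _ ⟨⟨x, rfl⟩, hx⟩ _ ⟨⟨y, rfl⟩, hy⟩ hxinf hyinf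
    have h1 := hle (φ ⁻¹' K) (hK.preimage φ.injective.injOn)
    rw [hends, Set.encard_le_one_iff] at h1
    rw [joined_map_iff, joined_compl_iff (K := φ ⁻¹' K) hx hy]
    exact h1 _ _ (infinite_supp_of_map hx hxinf) (infinite_supp_of_map hy hyinf)
  · obtain ⟨K, hK⟩ : ∃ K : Finset V,
        1 < {C : G.ComponentCompl (K : Set V) | C.supp.Infinite}.encard := by
      by_contra! hcon
      have : G.numEnds ≤ 1 := iSup_le hcon
      rw [hends] at this
      exact absurd this (by norm_num)
    refine ⟨False, K.toList.map φ, by simp, .inr ⟨id, hinf, connectedOn_range_map hconn, ?_, ?_⟩⟩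
    · have hpre : φ ⁻¹' {x | x ∈ K.toList.map φ} = K := by
        ext x
        simp
      obtain ⟨C, D, hC, hD, hCD⟩ := Set.one_lt_encard_iff.1 hK
      obtain ⟨x, hx, rfl⟩ := C.exists_eq_mk
      obtain ⟨y, hy, rfl⟩ := D.exists_eq_mk
      have hmem : ∀ x ∉ (K : Set V), φ x ∈ Set.range φ \ {x | x ∈ K.toList.map φ} :=
        fun x hx => ⟨⟨x, rfl⟩, fun h => hx (hpre ▸ h)⟩
      refine ⟨φ x, hmem x hx, φ y, hmem y hy, ?_, ?_, ?_⟩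
      · rw [componentIn_map, hpre, componentIn_compl hx]
        exact hC.image φ.injective.injOn
      · rw [componentIn_map, hpre, componentIn_compl hy]
        exact hD.image φ.injective.injOn
      · rw [joined_map_iff, hpre, joined_compl_iff hx hy]
        exact hCD
    · rintro K hK _ ⟨⟨x, rfl⟩, hx⟩ _ ⟨⟨y, rfl⟩, hy⟩ _ ⟨⟨z, rfl⟩, hz⟩ hxinf hyinf hzinf
      have h1 := hle (φ ⁻¹' K) (hK.preimage φ.injective.injOn)
      rw [joined_map_iff, joined_map_iff, joined_map_iff,
        joined_compl_iff (K := φ ⁻¹' K) hx hy, joined_compl_iff (K := φ ⁻¹' K) hx hz,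
        joined_compl_iff (K := φ ⁻¹' K) hy hz]
      by_contra! hcon
      have h2 : ({G.componentComplMk (K := φ ⁻¹' K) hx, G.componentComplMk (K := φ ⁻¹' K) hy,
          G.componentComplMk (K := φ ⁻¹' K) hz} : Set (G.ComponentCompl (φ ⁻¹' K))) ⊆
          {C | C.supp.Infinite} := by
        rintro C (rfl | rfl | rfl)
        · exact infinite_supp_of_map hx hxinf
        · exact infinite_supp_of_map hy hyinf
        · exact infinite_supp_of_map hz hzinf
      have h3 := (Set.encard_le_encard h2).trans h1
      rw [hends, Set.encard_eq_three.2 ⟨_, _, _, hcon.1, hcon.2.1, hcon.2.2, rfl⟩] at h3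
      exact absurd h3 (by norm_num)

theorem edist_le_three_of_map (h : (G.map φ).edist (φ v) (φ w) ≤ 3) : G.edist v w ≤ 3 := by
  have key : ∀ {a : V} {y : W}, φ a = y ∨ (G.map φ).Adj (φ a) y →
      ∃ b, φ b = y ∧ (a = b ∨ G.Adj a b) := by
    rintro a y (rfl | h)
    · exact ⟨a, rfl, .inl rfl⟩
    · obtain ⟨a', b, hab, ha, rfl⟩ := (map_adj _ _ _ _).1 h
      obtain rfl := φ.injective ha
      exact ⟨b, rfl, .inr hab⟩
  obtain ⟨_, h1, _, h2, h3⟩ := edist_le_three_iff.1 h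
  obtain ⟨b, rfl, hb⟩ := key h1
  obtain ⟨c, rfl, hc⟩ := key h2
  obtain ⟨d, hd, hd'⟩ := key h3
  obtain rfl := φ.injective hd
  exact edist_le_three_iff.2 ⟨b, hb, c, hc, hd'⟩

end Transport

end SimpleGraph

/-! ### From names back to vertices. -/

namespace BijNumbering

variable {V : Type*}

/-- The names, as an embedding. -/
def nameEmbedding (ν : BijNumbering V) : V ↪ ℕ :=
  ⟨fun v => ν.toEquiv.symm v, Subtype.val_injective.comp ν.toEquiv.symm.injective⟩

theorem nameEmbedding_apply (ν : BijNumbering V) (n : ℕ) (h : n ∈ ν.names) :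
    ν.nameEmbedding (ν.toEquiv ⟨n, h⟩) = n := by
  simp [nameEmbedding]

theorem range_nameEmbedding (ν : BijNumbering V) : Set.range ν.nameEmbedding = ν.names := by
  ext n
  exact ⟨fun ⟨v, hv⟩ => hv ▸ (ν.toEquiv.symm v).2, fun h => ⟨_, ν.nameEmbedding_apply n h⟩⟩

end BijNumbering

/-- A highly computable connected graph with one or two ends has a computable bi-infinite
Hamiltonian 3-path. -/
theorem SimpleGraph.IsHighlyComputable.exists_computable_equiv {V : Type*} {G : SimpleGraph V}
    {ν : BijNumbering V} (hG : G.IsHighlyComputable ν) (hconn : G.Connected)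
    (hends : G.numEnds = 1 ∨ G.numEnds = 2) :
    ∃ E : ℤ ≃ V, Computable (fun n => ν.nameEmbedding (E (Equiv.intEquivNat.symm n))) ∧
      ∀ z, G.edist (E z) (E (z + 1)) ≤ 3 := by
  -- A finite graph would have no ends.
  have : Infinite V := SimpleGraph.infinite_of_numEnds_ne_zero (G := G)
    (by rcases hends with h | h <;> simp [h])
  set φ := ν.nameEmbedding with hφ
  obtain ⟨one, K, hK, hE⟩ := SimpleGraph.endsAs_of_numEnds (φ := φ) hconn hends
  obtain ⟨dg, hdgc, hdg⟩ := hG.computable_degree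
  have hnbr : ∀ v, (G.map φ).neighborSet (φ v) = φ '' G.neighborSet v := by
    intro v
    ext y
    constructor
    · intro h
      obtain ⟨v', w, hvw, hv, rfl⟩ := (SimpleGraph.map_adj _ _ _ _).1 h
      obtain rfl := φ.injective hv
      exact ⟨w, hvw, rfl⟩
    · rintro ⟨w, hw, rfl⟩
      exact SimpleGraph.map_adj_apply.2 hw
  have hran : ∀ a b, (G.map φ).Adj a b → b ∈ Set.range φ := by
    intro a b h
    obtain ⟨v, w, -, -, rfl⟩ := (SimpleGraph.map_adj _ _ _ _).1 h
    exact ⟨w, rfl⟩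
  have hlf : ∀ a, ((G.map φ).neighborSet a).Finite := by
    intro a
    by_cases ha : a ∈ Set.range φ
    · obtain ⟨v, rfl⟩ := ha
      rw [hnbr]
      exact (hG.locallyFinite v).image _
    · rw [Set.eq_empty_of_forall_notMem (s := (G.map φ).neighborSet a)
        fun b hb => ha (hran b a hb.symm)]
      exact Set.finite_empty
  have hadj : SigmaOne fun x : ℕ × ℕ => (G.map φ).Adj x.1 x.2 := by
    refine (hG.computable.sigmaOne.comp Primrec₂.natPair).of_eq fun x => ?_
    rw [SimpleGraph.map_adj]
    constructor
    · rintro ⟨h, hadj⟩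
      refine ⟨_, _, hadj, ?_, ?_⟩
      · exact (ν.nameEmbedding_apply _ h.1).trans (by simp)
      · exact (ν.nameEmbedding_apply _ h.2).trans (by simp)
    · rintro ⟨v, w, hvw, hv, hw⟩
      have h : (ν.prod ν).toEquiv ((ν.prod ν).toEquiv.symm (v, w)) = (v, w) :=
        Equiv.apply_symm_apply _ _
      have h' : (((ν.prod ν).toEquiv.symm (v, w) : (ν.prod ν).names) : ℕ) =
          Nat.pair x.1 x.2 := by
        rw [← hv, ← hw]; rfl
      refine ⟨h' ▸ ((ν.prod ν).toEquiv.symm (v, w)).2, ?_⟩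
      have h'' : (⟨Nat.pair x.1 x.2, h' ▸ ((ν.prod ν).toEquiv.symm (v, w)).2⟩ :
          (ν.prod ν).names) = (ν.prod ν).toEquiv.symm (v, w) := Subtype.ext h'.symm
      rw [h'', h]
      exact hvw
  obtain ⟨e, hec, hinj, hrange, hstep⟩ := SimpleGraph.exists_computable_line hlf hran
    (dg := dg) (by
      rintro _ ⟨v, rfl⟩
      rw [hnbr, Set.ncard_image_of_injective _ φ.injective]
      have := hdg (ν.toEquiv.symm v)
      rw [Equiv.apply_symm_apply] at this
      exact this.symm) hdgc
    (by rw [hφ, ν.range_nameEmbedding]; exact ν.decidable_names) hadj hE hK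
  choose E hEe using fun z : ℤ => (hrange ▸ Set.mem_range_self z : e z ∈ Set.range φ)
  have hbij : Function.Bijective E := by
    constructor
    · intro y z hyz
      exact hinj (by rw [← hEe, ← hEe, hyz])
    · intro v
      obtain ⟨z, hz⟩ : φ v ∈ Set.range e := hrange ▸ Set.mem_range_self v
      exact ⟨z, φ.injective ((hEe z).trans hz)⟩
  refine ⟨Equiv.ofBijective E hbij, ?_, fun z => ?_⟩
  · simpa [hEe] using hec
  · refine SimpleGraph.edist_le_three_of_map (φ := φ) ?_
    simpa [hEe] using hstep z

/-! ### The action along the line. -/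

/-- The action of `ℤ` by translation along a bijection with `ℤ`. -/
abbrev Equiv.translationAction {V : Type*} (E : ℤ ≃ V) : AddAction ℤᵃᵒᵖ V where
  vadd z v := E (E.symm v + z.unop)
  zero_vadd v := by
    change E (E.symm v + 0) = v
    simp
  add_vadd x y v := by
    change E (E.symm v + (y.unop + x.unop)) = E (E.symm (E (E.symm v + y.unop)) + x.unop)
    rw [Equiv.symm_apply_apply, add_assoc]

theorem mainTheorem5 {V : Type*} (G : SimpleGraph V) (ν : BijNumbering V)
    (hG : G.IsHighlyComputable ν) (hconn : G.Connected)
    (hends : G.numEnds = 1 ∨ G.numEnds = 2) :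
    ∃ _ : AddAction ℤᵃᵒᵖ V,
      G.IsTranslationLike ℤ ∧
      AddAction.IsPretransitive ℤᵃᵒᵖ V ∧
      (ν.prod BijNumbering.int).IsComputable ν (fun p : V × ℤ => p.1 <+ᵥ p.2) ∧
      ∀ v : V, G.edist v (v <+ᵥ (1 : ℤ)) ≤ 3 := by
  obtain ⟨E, hEc, hstep⟩ := hG.exists_computable_equiv hconn hends
  have hdist : ∀ (n : ℕ) (z : ℤ), G.edist (E z) (E (z + n)) ≤ (3 * n : ℕ) := by
    intro n z
    induction n with
    | zero => simp
    | succ n ih =>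
      refine (SimpleGraph.edist_le_add ih (hstep (z + n))).trans_eq' ?_ |>.trans ?_
      · push_cast; rw [add_assoc]
      · push_cast; rw [mul_add, mul_one]
  let _ := E.translationAction
  refine ⟨E.translationAction, ⟨fun v z h => ?_, fun z => ?_⟩, ⟨fun v w => ?_⟩, ?_, fun v => ?_⟩
  · have h : E (E.symm v + z) = v := h
    rw [← Equiv.eq_symm_apply] at h
    simpa using h
  · refine ⟨3 * z.natAbs, fun v => ?_⟩
    change G.edist v (E (E.symm v + z)) ≤ _
    rcases Int.natAbs_eq z with hz | hz
    · have := hdist z.natAbs (E.symm v)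
      rwa [← hz, Equiv.apply_symm_apply] at this
    -- For negative `z`, walk forwards from the translated vertex back to `v`.
    · have := hdist z.natAbs (E.symm v + z)
      rw [show E.symm v + z + (z.natAbs : ℤ) = E.symm v by omega, Equiv.apply_symm_apply] at this
      exact SimpleGraph.edist_le_symm this
  · refine ⟨AddOpposite.op (E.symm w - E.symm v), ?_⟩
    change E (E.symm v + (E.symm w - E.symm v)) = w
    simp
  · obtain ⟨F, hF, hFE⟩ := exists_computable_int_translation hEc
      (ν.nameEmbedding.injective.comp E.injective) (N := ν.names)
      (by rw [Set.range_comp, E.range_eq_univ, Set.image_univ, ν.range_nameEmbedding])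
      ν.decidable_names
    refine ⟨F, hF, fun n => ?_⟩
    have h := hFE (E.symm (ν.toEquiv ⟨_, n.2.1⟩)) (Equiv.intEquivNat.symm n.1.unpair.2)
    simp only [Function.comp_apply, Equiv.apply_symm_apply, ν.nameEmbedding_apply,
      Nat.pair_unpair] at h
    exact h
  · have := hstep (E.symm v)
    rwa [Equiv.apply_symm_apply] at this
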